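/- Let $k$ be an algebraically closed field of characteristic $2$, $\overline X$ a projective variety over $k$ of even dimension $n>0$, $\mathcal L$ a line bundle on $\overline X$, and $M\subset H^0(\overline X,\mathcal L)$ a linear subspace of dimension $m+1$ with $m>n$. Let $\mathbf P=\mathbf P_*(M)$ be the $m$-dimensional projective space of lines in $M$; for $0\ne f\in M$ let $[f]\in\mathbf P$ be the corresponding point and $D_{[f]}$ the divisor $f=0$. Let $X$ be the complement in $\overline X$ of the singular locus and of the base locus of $|M|$, let $X^\circ\subset X$ be the open set of points where the differential of the morphism $X\to\mathbf P^\vee$ given by $|M|$ is injective, let $\mathcal D\subset X^\circ\times\mathbf P$ be the universal family of the divisors $D_{[f]}$, let $\mathcal C\subset\mathcal D$ be the critical subscheme of the projection $\mathcal D\to\mathbf P$, and let $\pi_2:\mathcal C\to\mathbf P$ be the projection. Let $P=(p,[f])$ be a closed point of $\mathcal C$ (so that $p\in X^\circ$ and $D_{[f]}$ is singular at $p$) such that the Hessian of $D_{[f]}$ at $p$ is degenerate. Let $\Lambda\subset L$ be linear subspaces of $\mathbf P$ of dimensions $2$ and $3$ with $[f]\in\Lambda$, and put $S_L=\pi_2^{-1}(L)$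 and $C_\Lambda=\pi_2^{-1}(\Lambda)$ (scheme-theoretic inverse images). Suppose that $S_L$ is smooth of dimension $2$ at $P$, and that $C_\Lambda$ is of codimension $1$ in $S_L$ at $P$, reduced and unibranch at $P$; that is, the local ring of $C_\Lambda$ at $P$ is a domain, and there is only one point $P'$ over $P$ in the normalization $\nu:\widetilde C_\Lambda\to C_\Lambda$ of $C_\Lambda$ at $P$. Let $z$ be a formal parameter of $\widetilde C_\Lambda$ at $P'$, so that $(\mathcal O_{\widetilde C_\Lambda,P'})^\wedge=k[[z]]$. Then the image of the homomorphism $(\mathcal O_{\Lambda,[f]})^\wedge\to k[[z]]$ induced by $\pi_2\circ\nu:\widetilde C_\Lambda\to\Lambda$ is contained in the subring $$T=\Big\{\textstyle\sum_\mu f_\mu z^\mu\in k[[z]] \;\Big|\; f_1=f_2=f_3=f_5=0\Big\}.$$ In particular, the image of every element of the maximal ideal of $(\mathcal O_{\Lambda,[f]})^\wedge$ is of the form $a\,z^4+(\text{terms of degree}\ge 6)$ with $a\in k$. -/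

import Mathlib

open CategoryTheory AlgebraicGeometry IsLocalRing

universe u

namespace DualVar

noncomputable section

attribute [local instance] MvPolynomial.gradedAlgebra

/-! ## Local algebra -/

section LocalAlgebra

/-- For a local ring `R`, the ideal of the point `(closed point, 0)` of `Spec R × 𝔸ᵐ`. -/
def originIdeal (R : Type*) [CommRing R] [IsLocalRing R] (m : ℕ) :
    Ideal (MvPolynomial (Fin m) R) :=
  (maximalIdeal R).comap MvPolynomial.constantCoeff

instance (R : Type*) [CommRing R] [IsLocalRing R] (m : ℕ) : (originIdeal R m).IsPrime :=
  Ideal.IsPrime.comap _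

/-- The local ring of `Spec R × 𝔸ᵐ` at `(closed point, 0)`.
For `R = k` this is the local ring of a projective `m`-space at the origin of an affine chart;
for `R = 𝒪_{X,p}` it is the local ring of `X × ℙᵐ` at the corresponding point. -/
def GermRing (R : Type*) [CommRing R] [IsLocalRing R] (m : ℕ) : Type _ :=
  Localization.AtPrime (originIdeal R m)

instance (R : Type*) [CommRing R] [IsLocalRing R] (m : ℕ) : CommRing (GermRing R m) :=
  inferInstanceAs (CommRing (Localization.AtPrime (originIdeal R m)))

instance (R : Type*) [CommRing R] [IsLocalRing R] (m : ℕ) :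
    Algebra (MvPolynomial (Fin m) R) (GermRing R m) :=
  inferInstanceAs (Algebra (MvPolynomial (Fin m) R) (Localization.AtPrime (originIdeal R m)))

instance (R : Type*) [CommRing R] [IsLocalRing R] (m : ℕ) :
    IsLocalization.AtPrime (GermRing R m) (originIdeal R m) :=
  inferInstanceAs
    (IsLocalization.AtPrime (Localization.AtPrime (originIdeal R m)) (originIdeal R m))

instance (R : Type*) [CommRing R] [IsLocalRing R] (m : ℕ) : IsLocalRing (GermRing R m) :=
  IsLocalization.AtPrime.isLocalRing (GermRing R m) (originIdeal R m)

instance (k R : Type*) [CommRing R] [IsLocalRing R] [CommRing k] [Algebra k R] (m : ℕ) :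
    Algebra k (GermRing R m) :=
  inferInstanceAs (Algebra k (Localization.AtPrime (originIdeal R m)))

instance (k R : Type*) [CommRing R] [IsLocalRing R] [CommRing k] [Algebra k R] (m : ℕ) :
    IsScalarTower k (MvPolynomial (Fin m) R) (GermRing R m) :=
  inferInstanceAs
    (IsScalarTower k (MvPolynomial (Fin m) R) (Localization.AtPrime (originIdeal R m)))

variable (k : Type*) [Field k] (O : Type*) [CommRing O] [IsLocalRing O] [Algebra k O]

theorem originIdeal_eq_comap (m : ℕ) :
    originIdeal k m = (originIdeal O m).comap (MvPolynomial.map (algebraMap k O)) := by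
  ext F
  simp only [originIdeal, Ideal.mem_comap, MvPolynomial.constantCoeff_map, mem_maximalIdeal,
    mem_nonunits_iff, isUnit_map_iff]

/-- Pull-back of functions along the second projection `X × ℙᵐ → ℙᵐ`, on local rings. -/
def pullbackPr₂ (m : ℕ) : GermRing k m →+* GermRing O m :=
  Localization.localRingHom (originIdeal k m) (originIdeal O m)
    (MvPolynomial.map (algebraMap k O)) (originIdeal_eq_comap k O m)

instance (m : ℕ) : IsLocalHom (pullbackPr₂ k O m) :=
  Localization.isLocalHom_localRingHom _ _ _ (originIdeal_eq_comap k O m)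

theorem pullbackPr₂_algebraMap (m : ℕ) (F : MvPolynomial (Fin m) k) :
    pullbackPr₂ k O m (algebraMap _ _ F) =
      algebraMap _ _ (MvPolynomial.map (algebraMap k O) F) :=
  Localization.localRingHom_to_map _ _ _ (originIdeal_eq_comap k O m) F

variable {k}

/-- For a morphism of smooth germs given by `ψ : Q → S` on local rings, the ideal of `S` generated
by the `r`-minors of the tangent map `Der_k(S, S) → Der_k(Q, S)`, `θ ↦ θ ∘ ψ`. When `r` is the
smaller one of the dimensions of the two germs, it defines the critical subscheme. -/
def minorsOfTangentMap (k : Type*) [Field k] {Q S : Type*} [CommRing Q] [CommRing S] [Algebra k S]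
    (ψ : Q →+* S) (r : ℕ) : Ideal S :=
  Ideal.span {a | ∃ (θ : Fin r → Derivation k S S) (g : Fin r → Q),
    a = Matrix.det (Matrix.of fun i j => θ j (ψ (g i)))}

end LocalAlgebra

/-! ## The germ of a linear system at a point

`O` is the local ring of the variety at `p`, `M` is the vector space of sections, and
`φ : M → O` sends a section to the germ at `p` of its quotient by a local frame of the line
bundle. A basis `b` of `M` gives homogeneous coordinates `Y₀, …, Y_m` of the projective space
of lines in `M`; the chosen point is `[f]` with `f = b 0`, and it is the origin of the affine
chart with the coordinates `yᵢ = Yᵢ / Y₀` (`i = 1, …, m`). -/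

section LinearSystemGerm

variable {k : Type*} [Field k] {O : Type*} [CommRing O] [IsLocalRing O] [Algebra k O]
  {M : Type*} [AddCommGroup M] [Module k M]

/-- `p` is not a base point. -/
def NotBasePoint (φ : M →ₗ[k] O) : Prop := ∃ t, IsUnit (φ t)

/-- The differential at `p` of the morphism `Ψ` to the dual projective space is injective:
a tangent vector `θ` at `p` that kills all the functions `s / t`, where `s, t` are in `M` and `t`
does not vanish at `p` (i.e. all pull-backs of affine coordinate functions), is zero. -/
def IsImmersiveAt (φ : M →ₗ[k] O) : Prop :=
  ∀ θ : Derivation k O (ResidueField O),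
    (∀ s t, IsUnit (φ t) → θ (φ s * Ring.inverse (φ t)) = 0) → θ = 0

variable {m : ℕ} (φ : M →ₗ[k] O) (b : Module.Basis (Fin (m + 1)) k M)

/-- The canonical section `σ = ∑ bᵢ ⊗ Yᵢ`, divided by (frame) `⊗ Y₀`:
`φ(b₀) + ∑ yᵢ φ(bᵢ)`. It defines the universal family `𝒟 ⊆ X × ℙᵐ` at `(p, [f])`. -/
def universalEq : GermRing O m :=
  algebraMap (MvPolynomial (Fin m) O) (GermRing O m)
    (MvPolynomial.C (φ (b 0)) +
      ∑ i : Fin m, MvPolynomial.X i * MvPolynomial.C (φ (b i.succ)))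

/-- The local ring of the universal family `𝒟` at `(p, [f])`. -/
abbrev UniversalFamilyRing : Type _ := GermRing O m ⧸ Ideal.span {universalEq φ b}

/-- The ideal, in the local ring of `X × ℙᵐ` at `(p, [f])`, of the critical subscheme `𝒞` of
the projection `𝒟 → ℙᵐ`. Here `dim 𝒟 = dim X + m - 1 ≥ m`, whence the `m`-minors. -/
def critIdeal : Ideal (GermRing O m) :=
  (minorsOfTangentMap k
    ((Ideal.Quotient.mk (Ideal.span {universalEq φ b})).comp (pullbackPr₂ k O m)) m).comap
    (Ideal.Quotient.mk (Ideal.span {universalEq φ b}))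

/-- The Hessian at `p` of the divisor `f = 0` is degenerate: for some vector field `θ` not
vanishing at `p`, the value `θ' (θ f)` at `p` vanishes for all vector fields `θ'`. -/
def HessianDegenerate (k : Type*) [Field k] {O : Type*} [CommRing O] [IsLocalRing O] [Algebra k O]
    (f : O) : Prop :=
  ∃ θ : Derivation k O O, (∃ h, residue O (θ h) ≠ 0) ∧
    ∀ θ' : Derivation k O O, residue O (θ' (θ f)) = 0

/-- `(p, [f])` is a point of `𝓡`: it is a point of `𝒞`, and the universal Hessian, which
at `(p, [f])` is the Hessian at `p` of the divisor of `f`, is degenerate there. -/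
def IsPointOfR : Prop := critIdeal φ b ≠ ⊤ ∧ HessianDegenerate k (φ (b 0))

/-- The ideal of the linear subspace `ℙ(V)` in the local ring of `ℙᵐ` at `[f]`: it is generated
by the affine equations of the linear forms on `M` that vanish on `V`. -/
def linearSubspaceIdeal (V : Submodule k M) : Ideal (GermRing k m) :=
  Ideal.span {a | ∃ l : Module.Dual k M, (∀ v ∈ V, l v = 0) ∧
    a = algebraMap (MvPolynomial (Fin m) k) (GermRing k m)
      (MvPolynomial.C (l (b 0)) +
        ∑ i : Fin m, MvPolynomial.X i * MvPolynomial.C (l (b i.succ)))}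

/-- The local ring of `ℙ(V)` at `[f]`. -/
abbrev LinearSubspaceRing (V : Submodule k M) : Type _ :=
  GermRing k m ⧸ linearSubspaceIdeal b V

/-- The maximal ideal of the local ring of `ℙ(V)` at `[f]` (for `f ∈ V`). -/
def linearSubspaceMaxIdeal (V : Submodule k M) : Ideal (LinearSubspaceRing b V) :=
  (maximalIdeal (GermRing k m)).map (Ideal.Quotient.mk (linearSubspaceIdeal b V))

/-- The ideal of `π₂⁻¹(ℙ(V)) ⊆ 𝒞` in the local ring of `X × ℙᵐ` at `(p, [f])`. -/
def sectionIdeal (V : Submodule k M) : Ideal (GermRing O m) :=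
  critIdeal φ b ⊔ (linearSubspaceIdeal b V).map (pullbackPr₂ k O m)

/-- The local ring at `(p, [f])` of the scheme-theoretic inverse image `π₂⁻¹(ℙ(V))` under
`π₂ : 𝒞 → ℙᵐ`. For `V` of dimension 4 it is the local ring of `SL`,
for `V` of dimension 3 it is the local ring of `C_Λ`. -/
abbrev SectionRing (V : Submodule k M) : Type _ := GermRing O m ⧸ sectionIdeal φ b V

/-- Pull-back of functions along `π₂⁻¹(ℙ(V)) → ℙ(V)`. -/
def sectionPullback (V : Submodule k M) : LinearSubspaceRing b V →+* SectionRing φ b V :=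
  Ideal.quotientMap (sectionIdeal φ b V) (pullbackPr₂ k O m)
    (Ideal.map_le_iff_le_comap.mp le_sup_right)

end LinearSystemGerm

/-! ## Normalization and completion -/

section Normalization

/-- The normalization of a domain: its integral closure in its field of fractions. -/
abbrev Normalization (A : Type*) [CommRing A] : Type _ := integralClosure A (FractionRing A)

/-- The homomorphism of completions induced by a homomorphism `f` with `f(I) ⊆ J`. -/
def completionMap {A B : Type*} [CommRing A] [CommRing B] (I : Ideal A) (J : Ideal B)
    (f : A →+* B) (h : I ≤ J.comap f) : AdicCompletion I A →+* AdicCompletion J B :=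
  AdicCompletion.liftRingHom J
    (fun n => (Ideal.quotientMap (J ^ n) f
      ((Ideal.pow_right_mono h n).trans (Ideal.le_comap_pow f n))).comp
        (AdicCompletion.evalₐ I n : AdicCompletion I A →+* A ⧸ I ^ n))
    (by
      intro a c hac
      ext x
      induction x using AdicCompletion.induction_on with
      | _ x =>
        simp only [RingHom.comp_apply, RingHom.coe_coe, AdicCompletion.evalₐ_mk,
          Ideal.quotientMap_mk, Ideal.Quotient.factorPow, Ideal.Quotient.factor_mk]
        rw [Ideal.Quotient.eq, ← map_sub]
        exact (Ideal.pow_right_mono h a).trans (Ideal.le_comap_pow f a)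
          (Ideal.Quotient.eq.mp (AdicCompletion.Ideal.mk_eq_mk I hac x)))

/-- The subring of `k⟦z⟧` of the power series whose coefficients of `z, z², z³, z⁵` vanish. -/
def subringT (k : Type*) [Field k] : Subring (PowerSeries k) where
  carrier := {F | PowerSeries.coeff 1 F = 0 ∧ PowerSeries.coeff 2 F = 0 ∧
    PowerSeries.coeff 3 F = 0 ∧ PowerSeries.coeff 5 F = 0}
  mul_mem' := by
    rintro F G ⟨h1, h2, h3, h5⟩ ⟨g1, g2, g3, g5⟩
    simp [PowerSeries.coeff_mul, Finset.Nat.antidiagonal_succ, h1, h2, h3, h5, g1, g2, g3, g5]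
  one_mem' := by simp [PowerSeries.coeff_one]
  add_mem' := by
    rintro F G ⟨h1, h2, h3, h5⟩ ⟨g1, g2, g3, g5⟩
    simp [h1, h2, h3, h5, g1, g2, g3, g5]
  zero_mem' := by simp
  neg_mem' := by
    rintro F ⟨h1, h2, h3, h5⟩
    simp [h1, h2, h3, h5]

variable {k : Type*} [Field k] {O : Type*} [CommRing O] [IsLocalRing O] [Algebra k O]
  {M : Type*} [AddCommGroup M] [Module k M] {m : ℕ}
  (φ : M →ₗ[k] O) (b : Module.Basis (Fin (m + 1)) k M)

/-- Pull-back of functions along the composite `C̃ → C → ℙ(V)`, where `C = π₂⁻¹(ℙ(V))` and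
`C̃ → C` is the normalization. -/
def normalizationPullback (V : Submodule k M) :
    LinearSubspaceRing b V →+* Normalization (SectionRing φ b V) :=
  (algebraMap (SectionRing φ b V) (Normalization (SectionRing φ b V))).comp (sectionPullback φ b V)

theorem linearSubspaceMaxIdeal_le (V : Submodule k M)
    [IsLocalRing (Normalization (SectionRing φ b V))] :
    linearSubspaceMaxIdeal b V ≤
      (maximalIdeal (Normalization (SectionRing φ b V))).comap (normalizationPullback φ b V) := by
  rw [linearSubspaceMaxIdeal, Ideal.map_le_iff_le_comap]
  intro x hx
  rw [Ideal.mem_comap, Ideal.mem_comap, mem_maximalIdeal, mem_nonunits_iff]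
  intro hu
  have hx' : pullbackPr₂ k O m x ∈ maximalIdeal (GermRing O m) := by
    rw [mem_maximalIdeal, mem_nonunits_iff] at hx ⊢
    exact fun h => hx (isUnit_of_map_unit (pullbackPr₂ k O m) x h)
  have hinj : Function.Injective (algebraMap (SectionRing φ b V)
      (Normalization (SectionRing φ b V))) := by
    intro a c hac
    exact IsFractionRing.injective (SectionRing φ b V) (FractionRing (SectionRing φ b V))
      (congrArg Subtype.val hac)
  have : FaithfulSMul (SectionRing φ b V) (Normalization (SectionRing φ b V)) :=
    (faithfulSMul_iff_algebraMap_injective _ _).mpr hinj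
  have hu' : IsUnit (Ideal.Quotient.mk (sectionIdeal φ b V) (pullbackPr₂ k O m x)) :=
    isUnit_of_map_unit (algebraMap (SectionRing φ b V) (Normalization (SectionRing φ b V))) _ hu
  obtain ⟨y, hy⟩ := hu'.exists_right_inv
  obtain ⟨y, rfl⟩ := Ideal.Quotient.mk_surjective y
  rw [← map_mul, ← map_one (Ideal.Quotient.mk (sectionIdeal φ b V)), Ideal.Quotient.eq] at hy
  have htop : sectionIdeal φ b V = ⊤ := by
    refine Ideal.eq_top_of_isUnit_mem _ hy ?_
    rw [← neg_sub, IsUnit.neg_iff]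
    exact isUnit_one_sub_self_of_mem_nonunits _ (Ideal.mul_mem_right y _ hx')
  have hsub : Subsingleton (SectionRing φ b V) := Ideal.Quotient.subsingleton_iff.mpr htop
  have : Subsingleton (Normalization (SectionRing φ b V)) :=
    (algebraMap (SectionRing φ b V) (Normalization (SectionRing φ b V))).codomain_trivial
  exact not_subsingleton (Normalization (SectionRing φ b V)) this

/-- The formal completion at `P'` of the morphism `C̃ → ℙ(V)`, on functions, where `C̃` has a
single point `P'` over `(p, [f])`. -/
def completedPullback (V : Submodule k M) [IsLocalRing (Normalization (SectionRing φ b V))] :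
    AdicCompletion (linearSubspaceMaxIdeal b V) (LinearSubspaceRing b V) →+*
      AdicCompletion (maximalIdeal (Normalization (SectionRing φ b V)))
        (Normalization (SectionRing φ b V)) :=
  completionMap _ _ (normalizationPullback φ b V) (linearSubspaceMaxIdeal_le φ b V)

end Normalization

/-! ## Varieties and line bundles over a field -/

section Varieties

variable {k : Type u} [Field k] {X : Scheme.{u}} (π : X ⟶ Spec (.of k))

/-- The structure homomorphism `k → Γ(X, 𝒪_X)` of a `k`-scheme. -/
def scalars : k →+* Γ(X, ⊤) := ((Scheme.ΓSpecIso (.of k)).inv ≫ π.appTop).hom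

/-- A closed subscheme of some projective space over `k`. -/
def IsProjective : Prop :=
  ∃ (N : ℕ) (i : X ⟶ Proj (MvPolynomial.homogeneousSubmodule (Fin (N + 1)) k)),
    IsClosedImmersion i ∧
      π = i ≫ Proj.toSpecZero (MvPolynomial.homogeneousSubmodule (Fin (N + 1)) k) ≫
        Spec.map (CommRingCat.ofHom
          (algebraMap k (MvPolynomial.homogeneousSubmodule (Fin (N + 1)) k 0)))

/-- The local ring of the `k`-scheme `X` at `p`. -/
def LocalRingAt (_π : X ⟶ Spec (.of k)) (p : X) : Type u := X.presheaf.stalk p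

instance (p : X) : CommRing (LocalRingAt π p) :=
  inferInstanceAs (CommRing (X.presheaf.stalk p))

instance (p : X) : IsLocalRing (LocalRingAt π p) :=
  inferInstanceAs (IsLocalRing (X.presheaf.stalk p))

/-- The germ at `p` of a function on `U`. -/
def germAt {U : X.Opens} (p : X) (hp : p ∈ U) : Γ(X, U) →+* LocalRingAt π p :=
  (X.presheaf.germ U p hp).hom

instance (p : X) : Algebra k (LocalRingAt π p) :=
  ((germAt π p (U := ⊤) trivial).comp (scalars π)).toAlgebra

/-- The global sections of a sheaf of modules on the `k`-scheme `X`, as a `k`-vector space. -/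
def GlobalSections (_π : X ⟶ Spec (.of k)) (L : X.Modules) : Type u := Γ(L, ⊤)

instance (L : X.Modules) : AddCommGroup (GlobalSections π L) :=
  inferInstanceAs (AddCommGroup Γ(L, ⊤))

instance (L : X.Modules) : Module Γ(X, ⊤) (GlobalSections π L) :=
  inferInstanceAs (Module Γ(X, ⊤) Γ(L, ⊤))

instance (L : X.Modules) : Module k (GlobalSections π L) :=
  Module.compHom _ (scalars π)

/-- Restriction of global sections to `U`. -/
def restrictTo (L : X.Modules) (U : X.Opens) : GlobalSections π L →+ Γ(L, U) :=
  (L.presheaf.map (homOfLE le_top : U ⟶ ⊤).op).hom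

/-- `e` is a frame of `L` over `U`: multiplication by `e` is an isomorphism `𝒪_U ≅ L|_U`. -/
def IsFrame (L : X.Modules) {U : X.Opens} (e : Γ(L, U)) : Prop :=
  ∀ (V : X.Opens) (h : V ≤ U),
    Function.Bijective fun r : Γ(X, V) => r • L.presheaf.map (homOfLE h).op e

/-- The isomorphism `r ↦ r • e` given by a frame, on the sections over `U`. -/
def frameEquiv (L : X.Modules) {U : X.Opens} (e : Γ(L, U)) (he : IsFrame L e) :
    Γ(X, U) ≃ₗ[Γ(X, U)] Γ(L, U) :=
  LinearEquiv.ofBijective (LinearMap.toSpanSingleton Γ(X, U) Γ(L, U) e) (by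
    have h := he U le_rfl
    have h1 : L.presheaf.map (homOfLE (le_refl U)).op e = e := by
      have : (homOfLE (le_refl U)).op = 𝟙 _ := rfl
      rw [this, CategoryTheory.Functor.map_id]
      rfl
    rw [h1] at h
    exact h)

/-- `L` is a line bundle. -/
def IsLineBundle (L : X.Modules) : Prop :=
  ∀ x : X, ∃ (U : X.Opens) (_ : x ∈ U) (e : Γ(L, U)), IsFrame L e

/-- The germ at `p` of the function `s / e`, for a global section `s` and a frame `e` over a
neighbourhood `U` of `p`. -/
def localExpression (L : X.Modules) {U : X.Opens} (e : Γ(L, U)) (he : IsFrame L e) (p : X)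
    (hp : p ∈ U) : GlobalSections π L →ₗ[k] LocalRingAt π p where
  toFun s := germAt π p hp ((frameEquiv L e he).symm (restrictTo π L U s))
  map_add' s t := by simp
  map_smul' c s := by
    have h : restrictTo π L U (c • s) =
        X.presheaf.map (homOfLE le_top : U ⟶ ⊤).op (scalars π c) • restrictTo π L U s :=
      Scheme.Modules.map_smul L (homOfLE le_top : U ⟶ ⊤) (scalars π c) s
    rw [h, map_smul, smul_eq_mul, map_mul, Algebra.smul_def, RingHom.id_apply]
    congr 1
    exact X.presheaf.germ_res_apply (homOfLE le_top : U ⟶ ⊤) p hp (scalars π c)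

/-- `X` is smooth over `k` of dimension `n` at `p`. -/
def IsSmoothOfDimAt (n : ℕ) (p : X) : Prop :=
  ∃ U : X.Opens, p ∈ U ∧ SmoothOfRelativeDimension n (U.ι ≫ π)

end Varieties

end

end DualVar

open DualVar

namespace DualVar

noncomputable section

/-! Take coordinates `x_i` on `X` at `p` with dual derivations `D_i`, and affine coordinates `y_j`
on `ℙᵐ` at `[f]`. Derivations are determined by their values on the `x_i`, so the constant fields
`D_c = ∑ c_i D_i` commute, and in characteristic 2 they satisfy `D_c² = 0`. Hence the Hessian of `f`
at `p` is alternating. Since `n` is even and the Hessian is degenerate, its kernel `K` has dimension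
at least 2 (`two_le_finrank_ker_hessian`).

The critical subscheme is cut out by the canonical section `σ = φ(b₀) + ∑ y_j φ(b_j)` and its
derivatives `D_i σ` (`universalEqDeriv_mem_critIdeal`, `critIdeal_le`). Linearizing these equations
shows that `K × 0` is tangent to the inverse image of every linear subspace through `[f]`.
Regularity of `S_L` in dimension 2 then forces `dim K = 2` and makes `K × 0` the whole tangent space
of `S_L` (`finrank_ker_hessian_and_tangent`).

Expand functions on `C_Λ` in powers of `z`. If a function in the maximal ideal had order 1, `C_Λ`
would coincide with its normalization and have a principal maximal ideal
(`maximalIdeal_eq_span_of_expansion`), although its tangent space contains the plane `K`. So all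
orders are at least 2 (`sq_dvd_of_not_principal`). The coefficients of `z²` and `z³` are then
tangent vectors `(a₂, 0)`, `(a₃, 0)` of `S_L` with `a₂, a₃ ∈ K`, and the `y_j` start at `z⁴`.

At `z⁵` the only nonlinear contribution is the one bilinear in `a₂` and `a₃`. It vanishes in `σ`
because `a₂ ∈ K`, and in `D_c σ` with `c ∈ K` because three fields from the plane `K` compose to
zero. What remains are linear conditions on the vector `y⁽⁵⁾` of `z⁵`-coefficients of the `y_j`.
They say that it lifts to a tangent vector `(ξ, y⁽⁵⁾)` of `S_L`, where `ξ` need not come from the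
curve; hence `y⁽⁵⁾ = 0` (`coeff_coordY_eq_zero`).

Membership in `T` involves only coefficients below `z⁶`, so an element of the completion may be
replaced by a close element of the local ring (`exists_evalₐ_eq_zero_imp_dvd`). -/

/-- Local coordinates on a local `k`-algebra with residue field `k`, together with the dual
derivations. -/
structure LocalCoords (k O : Type*) [Field k] [CommRing O] [IsLocalRing O] [Algebra k O]
    (ι : Type*) [DecidableEq ι] where
  x : ι → O
  D : ι → Derivation k O O
  ε : O →ₐ[k] k
  ker_ε : RingHom.ker ε = maximalIdeal O
  span_x : Ideal.span (Set.range x) = maximalIdeal O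
  D_x : ∀ i j, D i (x j) = if i = j then 1 else 0

theorem derivation_sum_apply {k A N ι : Type*} [CommRing k] [CommRing A] [Algebra k A]
    [AddCommGroup N] [Module A N] [Module k N] (s : Finset ι) (E : ι → Derivation k A N) (a : A) :
    (∑ i ∈ s, E i) a = ∑ i ∈ s, E i a := by
  classical
  induction s using Finset.induction_on with
  | empty => simp
  | insert i s hi ih => simp [Finset.sum_insert hi, ih]

/-! ### Derivations in local coordinates; constant vector fields in characteristic 2. -/

section LocalCoords

variable {k O ι : Type*} [Field k] [CommRing O] [IsLocalRing O] [Algebra k O] [Fintype ι]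
  [DecidableEq ι] (X : LocalCoords k O ι)

namespace LocalCoords

omit [Fintype ι] in
theorem ε_eq_zero_iff {g : O} : X.ε g = 0 ↔ g ∈ maximalIdeal O := by
  rw [← X.ker_ε, RingHom.mem_ker]

omit [Fintype ι] in
theorem x_mem (i : ι) : X.x i ∈ maximalIdeal O :=
  X.span_x ▸ Ideal.subset_span ⟨i, rfl⟩

omit [Fintype ι] in
theorem ε_x (i : ι) : X.ε (X.x i) = 0 := X.ε_eq_zero_iff.mpr (X.x_mem i)

theorem exists_eq_sum {g : O} (hg : g ∈ maximalIdeal O) : ∃ r : ι → O, g = ∑ i, r i * X.x i := by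
  rw [← X.span_x, Ideal.mem_span_range_iff_exists_fun] at hg
  obtain ⟨r, hr⟩ := hg
  exact ⟨r, hr.symm⟩

theorem exists_eq_add_sum (g : O) :
    ∃ r : ι → O, g = algebraMap k O (X.ε g) + ∑ i, r i * X.x i := by
  obtain ⟨r, hr⟩ := X.exists_eq_sum (g := g - algebraMap k O (X.ε g)) (by
    rw [← X.ε_eq_zero_iff]; simp)
  exact ⟨r, by rw [← hr]; ring⟩

section Derivations

variable {R : Type*} [CommRing R] [IsLocalRing R] [IsNoetherianRing R] [Algebra k R] [Algebra O R]
  [IsScalarTower k O R]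
  [IsLocalHom (algebraMap O R)]

omit [IsScalarTower k O R] in
include X in
-- Leibniz raises the order of vanishing: if all values of `E` lie in `𝔪^N`, then writing `g = g(p)
-- + ∑ r_i x_i` puts `E g` in `𝔪^(N+1)`. Krull's intersection theorem finishes.
theorem derivation_eq_zero (E : Derivation k O R) (hE : ∀ i, E (X.x i) = 0) : E = 0 := by
  have key : ∀ N : ℕ, ∀ g, E g ∈ maximalIdeal R ^ N := by
    intro N
    induction N with
    | zero => intro g; simp
    | succ N ih =>
      intro g
      obtain ⟨r, hr⟩ := X.exists_eq_add_sum g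
      rw [hr, map_add, Derivation.map_algebraMap, zero_add, map_sum]
      refine sum_mem fun i _ => ?_
      rw [Derivation.leibniz, hE, smul_zero, zero_add, pow_succ', Algebra.smul_def]
      refine Ideal.mul_mem_mul ?_ (ih _)
      have := X.x_mem i
      rw [mem_maximalIdeal, mem_nonunits_iff] at this ⊢
      exact fun h => this (isUnit_of_map_unit (algebraMap O R) _ h)
  ext g
  have h : E g ∈ ⨅ N : ℕ, maximalIdeal R ^ N := by
    rw [Ideal.mem_iInf]; exact fun N => key N g
  rwa [Ideal.iInf_pow_eq_bot_of_isLocalRing _ (IsLocalRing.maximalIdeal.isMaximal R).ne_top] at h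

/-- The difference of the two sides is a derivation that kills the coordinates. -/
theorem derivation_apply (E : Derivation k O R) (g : O) :
    E g = ∑ i, algebraMap O R (X.D i g) * E (X.x i) := by
  let E' : Derivation k O R := E - ∑ i, E (X.x i) • (Algebra.linearMap O R).compDer (X.D i)
  have h : ∀ g, E' g = E g - ∑ i, algebraMap O R (X.D i g) * E (X.x i) := by
    intro g
    simp only [E', Derivation.sub_apply]
    congr 1
    rw [derivation_sum_apply]
    refine Finset.sum_congr rfl fun i _ => ?_
    simp [mul_comm]
  have h0 : E' = 0 := X.derivation_eq_zero E' (fun j => by simp [h, X.D_x])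
  have := h g
  rw [h0, Derivation.zero_apply] at this
  exact (sub_eq_zero.mp this.symm)

end Derivations

/-- The constant vector field with the given coordinates. -/
def field (c : ι → k) : Derivation k O O := ∑ i, c i • X.D i

theorem field_apply (c : ι → k) (g : O) : X.field c g = ∑ i, c i • X.D i g := by
  simp [field, derivation_sum_apply]

theorem field_x (c : ι → k) (j : ι) : X.field c (X.x j) = algebraMap k O (c j) := by
  simp [field_apply, X.D_x, Algebra.smul_def]

theorem field_add (c d : ι → k) : X.field (c + d) = X.field c + X.field d := by
  simp [field, add_smul, Finset.sum_add_distrib]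

theorem field_smul (r : k) (c : ι → k) : X.field (r • c) = r • X.field c := by
  simp [field, mul_smul, Finset.smul_sum]

variable [IsNoetherianRing O]

instance isLocalHom_algebraMap_self : IsLocalHom (algebraMap O O) := ⟨fun _ h => h⟩

/-- The bracket is a derivation, and it kills the `x_i` because the fields take constant values
there. -/
theorem field_comm (c d : ι → k) (g : O) : X.field c (X.field d g) = X.field d (X.field c g) := by
  have h : ⁅X.field c, X.field d⁆ = 0 := X.derivation_eq_zero _ (fun i => by
    simp [Derivation.commutator_apply, field_x])
  have := congrArg (fun E => E g) h
  simpa [Derivation.commutator_apply, sub_eq_zero] using this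

variable [CharP k 2]

/-- In characteristic 2 the cross term of Leibniz for `D_c²` is doubled and disappears, so `D_c²` is
itself a derivation, and it kills the coordinates. -/
theorem field_field_self (c : ι → k) (g : O) : X.field c (X.field c g) = 0 := by
  have : CharP O 2 := charP_of_injective_algebraMap (algebraMap k O).injective 2
  let E : Derivation k O O := Derivation.mk'
    ((X.field c : O →ₗ[k] O) ∘ₗ (X.field c : O →ₗ[k] O)) (by
      intro a b
      simp only [LinearMap.comp_apply, Derivation.coeFn_coe, Derivation.leibniz, smul_eq_mul,
        map_add]
      have := CharTwo.add_self_eq_zero (X.field c a * X.field c b)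
      linear_combination this)
  have h : E = 0 := X.derivation_eq_zero E (fun i => by
    simp [E, field_x])
  exact congrArg (fun E => E g) h

end LocalCoords

end LocalCoords

/-! ### Alternating forms have even rank. -/

section Alternating

variable {K V : Type*} [Field K] [AddCommGroup V] [Module K V] [FiniteDimensional K V]

/-- Split off a hyperbolic plane spanned by `x, y` with `B x y ≠ 0`; the form stays nondegenerate on
its orthogonal complement. -/
theorem even_finrank_of_isAlt_of_nondegenerate (B : LinearMap.BilinForm K V) (hB : B.IsAlt)
    (hn : B.Nondegenerate) : Even (Module.finrank K V) := by
  induction h : Module.finrank K V using Nat.strong_induction_on generalizing V with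
  | _ d ih =>
  by_cases hd : d = 0
  · simp [hd]
  have : Nontrivial V := Module.nontrivial_of_finrank_pos (R := K) (by omega)
  obtain ⟨x, hx⟩ := exists_ne (0 : V)
  obtain ⟨y, hy⟩ : ∃ y, B x y ≠ 0 := by
    by_contra! hc
    exact hx (hn.1 x hc)
  have hxx : B x x = 0 := hB x
  have hyy : B y y = 0 := hB y
  have hyx : B y x = - B x y := (hB.neg_eq x y).symm
  have hli : LinearIndependent K ![x, y] := by
    rw [LinearIndependent.pair_iff]
    intro s t hst
    have h1 := congrArg (B x) hst
    have h2 := congrArg (B y) hst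
    simp [hxx, hyy, hyx, hy] at h1 h2
    exact ⟨h2, h1⟩
  let W : Submodule K V := Submodule.span K (Set.range ![x, y])
  have hW : Module.finrank K W = 2 := by
    simpa using finrank_span_eq_card hli
  have hxW : x ∈ W := Submodule.subset_span ⟨0, rfl⟩
  have hyW : y ∈ W := Submodule.subset_span ⟨1, rfl⟩
  have hdisj : Disjoint W (B.orthogonal W) := by
    rw [Submodule.disjoint_def]
    intro v hv hvo
    obtain ⟨a, b, rfl⟩ : ∃ a b : K, a • x + b • y = v := by
      have := hv
      simp only [W, Matrix.range_cons, Matrix.range_empty, Set.union_empty,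
        Set.singleton_union] at this
      exact Submodule.mem_span_pair.mp this
    have h1 := hvo x hxW
    have h2 := hvo y hyW
    simp [hxx, hyy, hyx, hy] at h1 h2
    simp [h1, h2]
  have hc : IsCompl W (B.orthogonal W) :=
    (LinearMap.BilinForm.isCompl_orthogonal_iff_disjoint hB.isRefl).mpr hdisj
  have hnd : (B.restrict (B.orthogonal W)).Nondegenerate := by
    rw [LinearMap.BilinForm.restrict_nondegenerate_iff_isCompl_orthogonal hB.isRefl,
      LinearMap.BilinForm.orthogonal_orthogonal hn hB.isRefl]
    exact hc.symm
  have hf := Submodule.finrank_add_eq_of_isCompl hc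
  have := ih (Module.finrank K (B.orthogonal W)) (by omega) (B.restrict (B.orthogonal W))
    (fun v => hB v) hnd rfl
  rw [← h, ← hf, hW]
  exact even_two.add this

/-- The form is nondegenerate on any complement of its radical. -/
theorem even_finrank_sub_finrank_ker_of_isAlt (B : LinearMap.BilinForm K V) (hB : B.IsAlt) :
    ∃ r, Even r ∧ Module.finrank K V = r + Module.finrank K (LinearMap.ker B) := by
  obtain ⟨U, hU⟩ := Submodule.exists_isCompl (LinearMap.ker B)
  have hf := Submodule.finrank_add_eq_of_isCompl hU
  refine ⟨Module.finrank K U, ?_, by omega⟩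
  refine even_finrank_of_isAlt_of_nondegenerate (B.restrict U) (fun v => hB v) ?_
  have hr : (B.restrict U).IsRefl := LinearMap.BilinForm.IsAlt.isRefl (fun v => hB v)
  have key : ∀ u : U, (∀ v : U, B u v = 0) → u = 0 := by
    intro u hu
    have hk : (u : V) ∈ LinearMap.ker B := by
      rw [LinearMap.mem_ker]
      ext v
      obtain ⟨a, ha, c, hc, rfl⟩ := Submodule.mem_sup.mp (hU.sup_eq_top ▸ Submodule.mem_top (x := v))
      have h1 : B u a = 0 := by
        apply hB.isRefl
        rw [LinearMap.mem_ker] at ha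
        simp [ha]
      simp [h1, hu ⟨c, hc⟩]
    exact Subtype.ext (Submodule.disjoint_def.mp hU.disjoint u hk u.2)
  refine ⟨fun u hu => key u hu, fun u hu => key u fun v => hr _ _ (hu v)⟩

end Alternating

/-! ### Coordinates and derivations on `Spec O × 𝔸ᵐ` at the origin. -/

section GermRing

variable {k O : Type*} [Field k] [CommRing O] [IsLocalRing O] [Algebra k O] {m : ℕ}

theorem algebraMap_germRing_apply (a : O) :
    algebraMap O (GermRing O m) a =
      algebraMap (MvPolynomial (Fin m) O) (GermRing O m) (MvPolynomial.C a) := by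
  rw [IsScalarTower.algebraMap_apply O (MvPolynomial (Fin m) O) (GermRing O m)]
  rfl

instance isScalarTower_germRing : IsScalarTower k O (GermRing O m) :=
  IsScalarTower.of_algebraMap_eq fun a => by
    rw [IsScalarTower.algebraMap_apply k (MvPolynomial (Fin m) O) (GermRing O m),
      IsScalarTower.algebraMap_apply O (MvPolynomial (Fin m) O) (GermRing O m),
      ← IsScalarTower.algebraMap_apply k O (MvPolynomial (Fin m) O)]

/-- The affine coordinates of the second factor. -/
def coordY (O : Type*) [CommRing O] [IsLocalRing O] {m : ℕ} (i : Fin m) : GermRing O m :=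
  algebraMap (MvPolynomial (Fin m) O) (GermRing O m) (MvPolynomial.X i)

instance isNoetherianRing_germRing [IsNoetherianRing O] : IsNoetherianRing (GermRing O m) :=
  IsLocalization.isNoetherianRing (originIdeal O m).primeCompl _ inferInstance

theorem maximalIdeal_germRing_eq_map :
    maximalIdeal (GermRing O m) = (originIdeal O m).map (algebraMap _ (GermRing O m)) :=
  (IsLocalization.AtPrime.map_eq_maximalIdeal (originIdeal O m) (GermRing O m)).symm

theorem coordY_mem (i : Fin m) : coordY O i ∈ maximalIdeal (GermRing O m) := by
  rw [maximalIdeal_germRing_eq_map]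
  exact Ideal.mem_map_of_mem _ (by simp [originIdeal])

theorem originIdeal_le :
    originIdeal O m ≤ (maximalIdeal O).map (MvPolynomial.C (σ := Fin m)) ⊔
      Ideal.span (Set.range MvPolynomial.X) := by
  intro F hF
  rw [originIdeal, Ideal.mem_comap] at hF
  have h : F - MvPolynomial.C (MvPolynomial.constantCoeff F) ∈
      Ideal.span (Set.range (MvPolynomial.X (R := O) (σ := Fin m))) := by
    clear hF
    induction F using MvPolynomial.induction_on with
    | C a => simp
    | add p q hp hq =>
      rw [map_add, map_add, add_sub_add_comm]
      exact add_mem hp hq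
    | mul_X p i _ =>
      rw [map_mul, MvPolynomial.constantCoeff_X, mul_zero, map_zero, sub_zero]
      exact Ideal.mul_mem_left _ _ (Ideal.subset_span ⟨i, rfl⟩)
  rw [← sub_add_cancel F (MvPolynomial.C (MvPolynomial.constantCoeff F))]
  exact add_mem (Ideal.mem_sup_right h) (Ideal.mem_sup_left (Ideal.mem_map_of_mem _ hF))

theorem maximalIdeal_germRing_eq :
    maximalIdeal (GermRing O m) = (maximalIdeal O).map (algebraMap O (GermRing O m)) ⊔
      Ideal.span (Set.range (coordY O)) := by
  apply le_antisymm
  · rw [maximalIdeal_germRing_eq_map]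
    refine (Ideal.map_mono originIdeal_le).trans ?_
    rw [Ideal.map_sup, Ideal.map_map, Ideal.map_span, ← Set.range_comp]
    refine sup_le_sup (le_of_eq ?_) le_rfl
    congr 1
  · refine sup_le ?_ (Ideal.span_le.mpr ?_)
    · rw [Ideal.map_le_iff_le_comap]
      intro a ha
      rw [Ideal.mem_comap, maximalIdeal_germRing_eq_map, algebraMap_germRing_apply]
      exact Ideal.mem_map_of_mem _ (by simpa [originIdeal] using ha)
    · rintro _ ⟨i, rfl⟩
      exact coordY_mem i

instance isLocalHom_algebraMap_germRing : IsLocalHom (algebraMap O (GermRing O m)) := by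
  constructor
  intro a ha
  by_contra h
  have h1 : a ∈ maximalIdeal O := h
  have h2 : algebraMap O (GermRing O m) a ∈ maximalIdeal (GermRing O m) := by
    rw [maximalIdeal_germRing_eq]
    exact Ideal.mem_sup_left (Ideal.mem_map_of_mem _ h1)
  exact h2 ha

section Extension

variable (D : Derivation k O (GermRing O m)) (c : Fin m → GermRing O m)

/-- The homomorphism `a ↦ a + (D a) ε` to the dual numbers given by a derivation. -/
def dualNumberHom : O →+* TrivSqZeroExt (GermRing O m) (GermRing O m) where
  toFun a := TrivSqZeroExt.inl (algebraMap O _ a) + TrivSqZeroExt.inr (D a)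
  map_one' := by ext <;> simp
  map_zero' := by ext <;> simp
  map_add' a b := by ext <;> simp
  map_mul' a b := by
    ext
    · simp
    · simp only [Derivation.leibniz, Algebra.smul_def]
      simp [mul_comm]

/-- The homomorphism to the dual numbers on polynomials. -/
def dualNumberPolyHom :
    MvPolynomial (Fin m) O →+* TrivSqZeroExt (GermRing O m) (GermRing O m) :=
  MvPolynomial.eval₂Hom (dualNumberHom D)
    fun i => TrivSqZeroExt.inl (coordY O i) + TrivSqZeroExt.inr (c i)

theorem fst_dualNumberPolyHom (F : MvPolynomial (Fin m) O) :
    (dualNumberPolyHom D c F).fst = algebraMap _ (GermRing O m) F := by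
  have : (TrivSqZeroExt.fstHom (GermRing O m) (GermRing O m) (GermRing O m)).toRingHom.comp
      (dualNumberPolyHom D c) = algebraMap _ (GermRing O m) := by
    apply MvPolynomial.ringHom_ext
    · intro a
      simp [dualNumberPolyHom, dualNumberHom, algebraMap_germRing_apply]
    · intro i
      simp [dualNumberPolyHom, coordY]
  exact congrArg (fun f => f F) this

/-- The homomorphism to the dual numbers on germs. -/
def dualNumberGermHom : GermRing O m →+* TrivSqZeroExt (GermRing O m) (GermRing O m) :=
  IsLocalization.lift (M := (originIdeal O m).primeCompl) (g := dualNumberPolyHom D c) (by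
    intro s
    rw [TrivSqZeroExt.isUnit_iff_isUnit_fst, fst_dualNumberPolyHom]
    exact IsLocalization.map_units _ s)

theorem fst_dualNumberGermHom (g : GermRing O m) : (dualNumberGermHom D c g).fst = g := by
  have : (TrivSqZeroExt.fstHom (GermRing O m) (GermRing O m) (GermRing O m)).toRingHom.comp
      (dualNumberGermHom D c) = RingHom.id _ := by
    apply IsLocalization.ringHom_ext (originIdeal O m).primeCompl
    refine RingHom.ext fun F => ?_
    simp [dualNumberGermHom, fst_dualNumberPolyHom]
  exact congrArg (fun f => f g) this

theorem dualNumberGermHom_algebraMap (a : O) :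
    dualNumberGermHom D c (algebraMap O _ a) =
      TrivSqZeroExt.inl (algebraMap O _ a) + TrivSqZeroExt.inr (D a) := by
  rw [algebraMap_germRing_apply, dualNumberGermHom, IsLocalization.lift_eq]
  simp [dualNumberPolyHom, dualNumberHom, algebraMap_germRing_apply]

theorem dualNumberGermHom_coordY (i : Fin m) :
    dualNumberGermHom D c (coordY O i) =
      TrivSqZeroExt.inl (coordY O i) + TrivSqZeroExt.inr (c i) := by
  rw [coordY, dualNumberGermHom, IsLocalization.lift_eq]
  simp [dualNumberPolyHom, coordY]

/-- The derivation of `GermRing O m` extending `D`, with given values on the coordinates. -/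
def germDerivation : Derivation k (GermRing O m) (GermRing O m) :=
  Derivation.mk'
    { toFun := fun g => (dualNumberGermHom D c g).snd
      map_add' := by simp
      map_smul' := by
        intro r g
        rw [Algebra.smul_def, IsScalarTower.algebraMap_apply k O (GermRing O m), map_mul,
          dualNumberGermHom_algebraMap]
        simp [Algebra.smul_def, ← IsScalarTower.algebraMap_apply k O (GermRing O m)] }
    (by
      intro a b
      simp [fst_dualNumberGermHom, mul_comm])

theorem germDerivation_algebraMap (a : O) : germDerivation D c (algebraMap O _ a) = D a := by
  simp [germDerivation, dualNumberGermHom_algebraMap]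

theorem germDerivation_coordY (i : Fin m) : germDerivation D c (coordY O i) = c i := by
  simp [germDerivation, dualNumberGermHom_coordY]

end Extension

section Value

variable (e : O →ₐ[k] k) (he : RingHom.ker e = maximalIdeal O)

/-- The value at the origin. -/
def germValue : GermRing O m →ₐ[k] k :=
  { IsLocalization.lift (M := (originIdeal O m).primeCompl)
      (g := (e : O →+* k).comp MvPolynomial.constantCoeff) (by
        intro s
        rw [isUnit_iff_ne_zero]
        intro h
        apply s.2
        change MvPolynomial.constantCoeff s.1 ∈ maximalIdeal O
        rw [← he]
        exact h) with
    commutes' := by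
      intro r
      simp [IsScalarTower.algebraMap_apply k (MvPolynomial (Fin m) O) (GermRing O m),
        IsLocalization.lift_eq, MvPolynomial.algebraMap_apply] }

theorem germValue_algebraMap (a : O) : germValue (m := m) e he (algebraMap O _ a) = e a := by
  simp [germValue, algebraMap_germRing_apply, IsLocalization.lift_eq]

theorem ker_germValue : RingHom.ker (germValue (m := m) e he) = maximalIdeal (GermRing O m) := by
  have hs : Function.Surjective (germValue (m := m) e he) := fun r =>
    ⟨algebraMap k _ r, by simp⟩
  have := RingHom.ker_isMaximal_of_surjective (germValue (m := m) e he) hs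
  exact IsLocalRing.eq_maximalIdeal this

end Value

variable {ι : Type*} [Fintype ι] [DecidableEq ι]

/-- Local coordinates on `Spec O × 𝔸ᵐ`. -/
def LocalCoords.germ (X : LocalCoords k O ι) (m : ℕ) :
    LocalCoords k (GermRing O m) (ι ⊕ Fin m) where
  x := Sum.elim (fun i => algebraMap O _ (X.x i)) (coordY O)
  D := Sum.elim (fun i => germDerivation ((Algebra.linearMap O (GermRing O m)).compDer (X.D i)) 0)
    (fun i => germDerivation 0 (fun j => if i = j then 1 else 0))
  ε := germValue X.ε X.ker_ε
  ker_ε := ker_germValue X.ε X.ker_ε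
  span_x := by
    rw [Set.Sum.elim_range, Ideal.span_union, maximalIdeal_germRing_eq, ← X.span_x, Ideal.map_span,
      ← Set.range_comp]
    rfl
  D_x := by
    rintro (i | i) (j | j) <;>
      simp [germDerivation_algebraMap, germDerivation_coordY, X.D_x, apply_ite]

variable (X : LocalCoords k O ι)

omit [Fintype ι] in
@[simp] theorem LocalCoords.germ_x_inr (i : Fin m) : (X.germ m).x (Sum.inr i) = coordY O i := rfl

omit [Fintype ι] in
@[simp] theorem LocalCoords.germ_D_inl_algebraMap (i : ι) (a : O) :
    (X.germ m).D (Sum.inl i) (algebraMap O _ a) = algebraMap O _ (X.D i a) :=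
  germDerivation_algebraMap _ _ a

omit [Fintype ι] in
@[simp] theorem LocalCoords.germ_D_inl_coordY (i : ι) (j : Fin m) :
    (X.germ m).D (Sum.inl i) (coordY O j) = 0 :=
  germDerivation_coordY _ _ j

omit [Fintype ι] in
@[simp] theorem LocalCoords.germ_D_inr_algebraMap (i : Fin m) (a : O) :
    (X.germ m).D (Sum.inr i) (algebraMap O _ a) = 0 :=
  germDerivation_algebraMap _ _ a

omit [Fintype ι] in
@[simp] theorem LocalCoords.germ_D_inr_coordY (i j : Fin m) :
    (X.germ m).D (Sum.inr i) (coordY O j) = if i = j then 1 else 0 :=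
  germDerivation_coordY _ _ j

omit [Fintype ι] in
@[simp] theorem LocalCoords.germ_ε_algebraMap (a : O) :
    (X.germ m).ε (algebraMap O _ a) = X.ε a :=
  germValue_algebraMap X.ε X.ker_ε a

omit [Fintype ι] in
@[simp] theorem LocalCoords.germ_ε_coordY (i : Fin m) : (X.germ m).ε (coordY O i) = 0 :=
  (X.germ m).ε_x (Sum.inr i)

/-- The coordinates on a point. -/
def pointCoords (k : Type*) [Field k] : LocalCoords k k (Fin 0) where
  x := Fin.elim0
  D := Fin.elim0
  ε := AlgHom.id k k
  ker_ε := by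
    rw [IsLocalRing.maximalIdeal_eq_bot]
    exact (RingHom.injective_iff_ker_eq_bot (AlgHom.id k k : k →+* k)).mp Function.injective_id
  span_x := by rw [IsLocalRing.maximalIdeal_eq_bot]; simp
  D_x := fun i => i.elim0

end GermRing

/-! ### Explicit equations of the critical subscheme. -/

section Critical

variable {k O : Type*} [Field k] [CommRing O] [IsLocalRing O] [Algebra k O] {m : ℕ}
  {M : Type*} [AddCommGroup M] [Module k M] (φ : M →ₗ[k] O) (b : Module.Basis (Fin (m + 1)) k M)

theorem universalEq_eq : universalEq φ b = algebraMap O _ (φ (b 0)) +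
    ∑ i, coordY O i * algebraMap O _ (φ (b i.succ)) := by
  simp [universalEq, coordY, algebraMap_germRing_apply]

theorem pullbackPr₂_coordY (i : Fin m) : pullbackPr₂ k O m (coordY k i) = coordY O i := by
  rw [coordY, pullbackPr₂_algebraMap, MvPolynomial.map_X, coordY]

theorem pullbackPr₂_algebraMap_base (r : k) :
    pullbackPr₂ k O m (algebraMap k _ r) = algebraMap k _ r := by
  rw [algebraMap_germRing_apply, pullbackPr₂_algebraMap, MvPolynomial.map_C,
    ← algebraMap_germRing_apply, ← IsScalarTower.algebraMap_apply]

/-- The derivative of the canonical section by a vector field on the first factor. -/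
def universalEqDeriv (E : Derivation k O O) : GermRing O m :=
  algebraMap O _ (E (φ (b 0))) + ∑ i, coordY O i * algebraMap O _ (E (φ (b i.succ)))

variable {ι : Type*} [DecidableEq ι] [Fintype ι] (X : LocalCoords k O ι)

omit [Fintype ι] in
theorem germ_D_inl_universalEq (l : ι) :
    (X.germ m).D (Sum.inl l) (universalEq φ b) = universalEqDeriv φ b (X.D l) := by
  simp [universalEq_eq, universalEqDeriv]

omit [Fintype ι] in
theorem germ_D_inr_universalEq (i : Fin m) :
    (X.germ m).D (Sum.inr i) (universalEq φ b) = algebraMap O _ (φ (b i.succ)) := by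
  simp [universalEq_eq]

theorem span_universalEq_le_critIdeal : Ideal.span {universalEq φ b} ≤ critIdeal φ b := by
  intro a ha
  rw [critIdeal, Ideal.mem_comap, Ideal.Quotient.eq_zero_iff_mem.mpr ha]
  exact zero_mem _

theorem critIdeal_le_maximalIdeal (h : critIdeal φ b ≠ ⊤) :
    critIdeal φ b ≤ maximalIdeal (GermRing O m) := IsLocalRing.le_maximalIdeal h

theorem universalEq_mem (h : critIdeal φ b ≠ ⊤) :
    universalEq φ b ∈ maximalIdeal (GermRing O m) :=
  critIdeal_le_maximalIdeal φ b h
    (span_universalEq_le_critIdeal φ b (Ideal.mem_span_singleton_self _))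

theorem mem_of_algebraMap_mem {a : O} (h : algebraMap O (GermRing O m) a ∈ maximalIdeal _) :
    a ∈ maximalIdeal O := by
  rw [mem_maximalIdeal, mem_nonunits_iff] at h ⊢
  exact fun hu => h (hu.map _)

theorem phi_zero_mem (h : critIdeal φ b ≠ ⊤) : φ (b 0) ∈ maximalIdeal O := by
  apply mem_of_algebraMap_mem (m := m)
  have := universalEq_mem φ b h
  rw [universalEq_eq] at this
  exact (Ideal.add_mem_iff_left _
    (sum_mem fun i _ => Ideal.mul_mem_right _ _ (coordY_mem i))).mp this

/-- At a point of `𝒞` the section `f = b 0` vanishes at `p`, so a section not vanishing there must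
involve another basis vector. -/
theorem exists_isUnit_phi (h : critIdeal φ b ≠ ⊤) (hφ : NotBasePoint φ) :
    ∃ i : Fin m, IsUnit (φ (b i.succ)) := by
  by_contra! hc
  obtain ⟨t, ht⟩ := hφ
  refine (mem_maximalIdeal _).mp ?_ ht
  rw [← b.sum_repr t, map_sum]
  refine sum_mem fun i _ => ?_
  rw [map_smul]
  refine Submodule.smul_of_tower_mem _ _ ?_
  induction i using Fin.cases with
  | zero => exact phi_zero_mem φ b h
  | succ i => exact (mem_maximalIdeal _).mpr (hc i)

variable {φ b}

omit [Fintype ι] in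
-- Since `∂σ/∂y_{i₀} = φ(b_{i₀})` is a unit, every field on the product can be corrected by a
-- multiple of `∂/∂y_{i₀}` so as to kill `σ` and descend to `𝒟`. A suitable choice of `m` such
-- fields has a minor equal to `D_l σ` up to a unit.
theorem universalEqDeriv_mem_critIdeal {i₀ : Fin m} (hi₀ : IsUnit (φ (b i₀.succ))) (l : ι) :
    universalEqDeriv φ b (X.D l) ∈ critIdeal φ b := by
  set q := Ideal.Quotient.mk (Ideal.span {universalEq φ b})
  obtain ⟨v, hv⟩ := hi₀.exists_left_inv
  let w : GermRing O m := algebraMap O _ v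
  have hw : w * algebraMap O _ (φ (b i₀.succ)) = 1 := by rw [← map_mul, hv, map_one]
  let Y := X.germ m
  have hlift : ∀ E : Derivation k (GermRing O m) (GermRing O m), E (universalEq φ b) = 0 →
      ∃ E' : Derivation k (UniversalFamilyRing φ b) (UniversalFamilyRing φ b),
        ∀ g, E' (q g) = q (E g) := by
    intro E hE
    refine ⟨Derivation.liftOfSurjective (f := Ideal.Quotient.mkₐ k (Ideal.span {universalEq φ b}))
      (Ideal.Quotient.mkₐ_surjective _ _) (d := E) ?_, fun g => ?_⟩
    · intro g hg
      obtain ⟨a, rfl⟩ := Ideal.mem_span_singleton.mp (Ideal.Quotient.eq_zero_iff_mem.mp hg)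
      rw [Derivation.leibniz, hE, smul_zero, add_zero, smul_eq_mul, map_mul]
      have : Ideal.Quotient.mkₐ k (Ideal.span {universalEq φ b}) (universalEq φ b) = 0 :=
        Ideal.Quotient.eq_zero_iff_mem.mpr (Ideal.mem_span_singleton_self _)
      rw [this, zero_mul]
    · exact Derivation.liftOfSurjective_apply _ _ g
  have hmod : ∀ E : Derivation k (GermRing O m) (GermRing O m),
      (E - (w * E (universalEq φ b)) • Y.D (Sum.inr i₀)) (universalEq φ b) = 0 := by
    intro E
    rw [Derivation.sub_apply, Derivation.smul_apply, germ_D_inr_universalEq, smul_eq_mul]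
    linear_combination -(E (universalEq φ b)) * hw
  -- The fields `∂/∂y_j` are used for `j ≠ i₀`, and `∂/∂x_l` takes the place of `∂/∂y_{i₀}`. After
  -- correction the matrix of values on the `y_i` is the identity except in row `i₀`, whose diagonal
  -- entry is `-w D_l σ`.
  let s : Fin m → ι ⊕ Fin m := fun j => if j = i₀ then Sum.inl l else Sum.inr j
  choose θ hθ using fun j => hlift _ (hmod (Y.D (s j)))
  have hdet : q (universalEqDeriv φ b (X.D l)) = q (-algebraMap O _ (φ (b i₀.succ))) *
      Matrix.det (Matrix.of fun i j => θ j ((q.comp (pullbackPr₂ k O m)) (coordY k i))) := by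
    have hM : (Matrix.of fun i j => θ j ((q.comp (pullbackPr₂ k O m)) (coordY k i))) =
        (Matrix.updateRow 1 i₀
          (fun j => q (-(w * Y.D (s j) (universalEq φ b))))) := by
      ext i j
      rw [Matrix.of_apply, RingHom.comp_apply, pullbackPr₂_coordY, hθ, Derivation.sub_apply,
        Derivation.smul_apply]
      by_cases hj : j = i₀
      · subst hj
        by_cases hi : i = j
        · subst hi; simp [Y, s, germ_D_inl_universalEq]
        · simp [Y, s, hi, Ne.symm hi]
      · by_cases hi : i = i₀
        · subst hi
          simp [Y, s, hj, germ_D_inr_universalEq]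
        · by_cases hij : j = i
          · subst hij; simp [Y, s, hj, Ne.symm hi]
          · simp [Y, s, hj, hi, hij, Ne.symm hi, Ne.symm hij]
    rw [hM, ← Matrix.det_transpose, ← Matrix.updateCol_transpose, ← Matrix.cramer_apply,
      Matrix.transpose_one, Matrix.cramer_one]
    simp only [Y, s, if_true, germ_D_inl_universalEq, Module.End.one_apply]
    rw [← map_mul]
    congr 1
    linear_combination -(universalEqDeriv φ b (X.D l)) * hw
  rw [critIdeal, Ideal.mem_comap]
  change q _ ∈ _
  rw [hdet]
  exact Ideal.mul_mem_left _ _ (Ideal.subset_span ⟨θ, coordY k, rfl⟩)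

/-- A field `θ` on `𝒟` satisfies `θ σ = 0`, that is `∑ φ(b_l) θ(y_l) = -∑ (D_l σ) θ(x_l)`. Modulo
the `D_l σ` this is a linear relation between the rows of `(θ_j(y_l))` with a unit among its
coefficients, so the determinant vanishes there. -/
theorem critIdeal_le [IsNoetherianRing O] (h : critIdeal φ b ≠ ⊤) {i₀ : Fin m}
    (hi₀ : IsUnit (φ (b i₀.succ))) :
    critIdeal φ b ≤ Ideal.span {universalEq φ b} ⊔
      Ideal.span (Set.range fun l => universalEqDeriv φ b (X.D l)) := by
  set J := Ideal.span (Set.range fun l => universalEqDeriv φ b (X.D l))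
  set q := Ideal.Quotient.mk (Ideal.span {universalEq φ b}) with hq
  have hne : Ideal.span {universalEq φ b} ≠ ⊤ := fun h' => h
    (top_le_iff.mp (h' ▸ span_universalEq_le_critIdeal φ b))
  have : Nontrivial (UniversalFamilyRing φ b) := Ideal.Quotient.nontrivial_iff.mpr hne
  have : IsLocalRing (UniversalFamilyRing φ b) :=
    IsLocalRing.of_surjective' q Ideal.Quotient.mk_surjective
  have hqloc : IsLocalHom q := IsLocalHom.of_surjective q Ideal.Quotient.mk_surjective
  suffices hs : minorsOfTangentMap k (q.comp (pullbackPr₂ k O m)) m ≤ J.map q by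
    refine (Ideal.comap_mono hs).trans ?_
    rw [Ideal.comap_map_of_surjective q Ideal.Quotient.mk_surjective, sup_comm,
      ← RingHom.ker_eq_comap_bot, hq, Ideal.mk_ker]
  rw [minorsOfTangentMap, Ideal.span_le]
  rintro _ ⟨θ, g, rfl⟩
  let : Algebra (GermRing k m) (UniversalFamilyRing φ b) := (q.comp (pullbackPr₂ k O m)).toAlgebra
  have : IsScalarTower k (GermRing k m) (UniversalFamilyRing φ b) :=
    IsScalarTower.of_algebraMap_eq fun r => by
      change _ = q (pullbackPr₂ k O m _)
      rw [pullbackPr₂_algebraMap_base]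
      rfl
  have : IsLocalHom (algebraMap (GermRing k m) (UniversalFamilyRing φ b)) :=
    inferInstanceAs (IsLocalHom (q.comp (pullbackPr₂ k O m)))
  have : IsLocalHom (algebraMap O (UniversalFamilyRing φ b)) := by
    have : algebraMap O (UniversalFamilyRing φ b) = q.comp (algebraMap O (GermRing O m)) := rfl
    rw [this]
    infer_instance
  -- By the chain rule on `ℙᵐ`, a minor for arbitrary functions `g i` is a multiple of the minor for
  -- the coordinates `y_l`.
  have hexp : ∀ j i, θ j ((q.comp (pullbackPr₂ k O m)) (g i)) =
      ∑ l, (q.comp (pullbackPr₂ k O m)) (((pointCoords k).germ m).D (Sum.inr l) (g i)) *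
        θ j (q (coordY O l)) := by
    intro j i
    have := ((pointCoords k).germ m).derivation_apply
      ((θ j).compAlgebraMap (GermRing k m)) (g i)
    rw [Fintype.sum_sum_type] at this
    simp only [Finset.univ_eq_empty, Finset.sum_empty, zero_add, LocalCoords.germ_x_inr] at this
    refine this.trans (Finset.sum_congr rfl fun l _ => ?_)
    congr 1
    change θ j (q (pullbackPr₂ k O m _)) = _
    rw [pullbackPr₂_coordY]
  let A : Matrix (Fin m) (Fin m) (UniversalFamilyRing φ b) :=
    Matrix.of fun l j => θ j (q (coordY O l))
  let B : Matrix (Fin m) (Fin m) (UniversalFamilyRing φ b) :=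
    Matrix.of fun i l => (q.comp (pullbackPr₂ k O m)) (((pointCoords k).germ m).D (Sum.inr l) (g i))
  have hM : (Matrix.of fun i j => θ j ((q.comp (pullbackPr₂ k O m)) (g i))) = B * A := by
    ext i j
    rw [Matrix.of_apply, hexp, Matrix.mul_apply]
    rfl
  rw [hM, Matrix.det_mul, SetLike.mem_coe]
  refine Ideal.mul_mem_left _ _ ?_
  have hqσ : q (universalEq φ b) = 0 :=
    Ideal.Quotient.eq_zero_iff_mem.mpr (Ideal.mem_span_singleton_self _)
  have hrel : ∀ j, ∑ l, q (algebraMap O _ (φ (b l.succ))) * A l j ∈ J.map q := by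
    intro j
    obtain ⟨t, ht⟩ : ∃ t : ι → UniversalFamilyRing φ b, ∀ a : O, θ j (q (algebraMap O _ a)) =
        ∑ l, q (algebraMap O _ (X.D l a)) * t l :=
      ⟨_, fun a => X.derivation_apply ((θ j).compAlgebraMap O) a⟩
    have h0 : θ j (q (universalEq φ b)) = 0 := by rw [hqσ, map_zero]
    have h1 : θ j (q (universalEq φ b)) = ∑ l, q (algebraMap O _ (φ (b l.succ))) * A l j +
        ∑ l, q (universalEqDeriv φ b (X.D l)) * t l := by
      simp only [universalEq_eq, universalEqDeriv, map_add, map_sum, map_mul, Derivation.leibniz,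
        ht, smul_eq_mul, A, Matrix.of_apply, add_mul, Finset.sum_add_distrib, Finset.mul_sum,
        Finset.sum_mul]
      rw [Finset.sum_comm]
      simp only [mul_assoc]
      ring
    rw [h0] at h1
    rw [eq_neg_of_add_eq_zero_left h1.symm]
    refine neg_mem (sum_mem fun l _ => Ideal.mul_mem_right _ _ (Ideal.mem_map_of_mem _ ?_))
    exact Ideal.subset_span ⟨l, rfl⟩
  obtain ⟨v, hv⟩ := hi₀.exists_left_inv
  -- Multiplying the relation by the adjugate gives `det A · φ(b_{i₀})`, and `φ(b_{i₀})` is a unit.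
  have hcr : A.det * q (algebraMap O _ (φ (b i₀.succ))) ∈ J.map q := by
    have h1 : Matrix.vecMul (Matrix.vecMul (fun l => q (algebraMap O _ (φ (b l.succ)))) A)
        A.adjugate i₀ = A.det * q (algebraMap O _ (φ (b i₀.succ))) := by
      rw [Matrix.vecMul_vecMul, Matrix.mul_adjugate, Matrix.vecMul_smul, Matrix.vecMul_one]
      simp
    rw [← h1, Matrix.vecMul, dotProduct]
    exact sum_mem fun j _ => Ideal.mul_mem_right _ _ (hrel j)
  have : A.det = q (algebraMap O _ v) * (A.det * q (algebraMap O _ (φ (b i₀.succ)))) := by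
    rw [mul_left_comm, ← map_mul, ← map_mul, hv, map_one, map_one, mul_one]
  rw [this]
  exact Ideal.mul_mem_left _ _ hcr

end Critical

/-! ### Finiteness of the normalization over a perfect field. -/

section FiniteNormalization

theorem finite_of_comp_of_injective {P N B : Type*} [CommRing P] [IsNoetherianRing P] [CommRing N]
    [CommRing B] (f : P →+* N) (g : N →+* B) (hg : Function.Injective g) (h : (g.comp f).Finite) :
    f.Finite := by
  let : Algebra P N := f.toAlgebra
  let : Algebra N B := g.toAlgebra
  let : Algebra P B := (g.comp f).toAlgebra
  have : IsScalarTower P N B := IsScalarTower.of_algebraMap_eq fun _ => rfl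
  have : Module.Finite P B := h
  exact Module.Finite.of_injective (IsScalarTower.toAlgHom P N B).toLinearMap hg

/-- Each `a` is a root of `X^(p^n) - a`, with the coefficient `a` read through Frobenius, so the map
is integral. It is of finite type because Frobenius is onto on the perfect field of constants. -/
theorem iterateFrobenius_mvPolynomial_finite {k : Type*} [Field k] (p : ℕ) [ExpChar k p]
    [PerfectRing k p] (s n : ℕ) : (iterateFrobenius (MvPolynomial (Fin s) k) p n).Finite := by
  refine RingHom.IsIntegral.to_finite (fun a => ?_) ?_
  · refine ⟨Polynomial.X ^ p ^ n - Polynomial.C a,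
      Polynomial.monic_X_pow_sub_C _ (pow_ne_zero _ (expChar_ne_zero k p)), ?_⟩
    simp [iterateFrobenius_def]
  · refine RingHom.FiniteType.of_comp_finiteType (f := MvPolynomial.C) ?_
    have : (iterateFrobenius (MvPolynomial (Fin s) k) p n).comp MvPolynomial.C =
        MvPolynomial.C.comp (iterateFrobenius k p n) := by
      ext1 r
      simp [iterateFrobenius_def]
    rw [this]
    refine RingHom.FiniteType.comp ?_ (RingHom.FiniteType.of_surjective _
      (bijective_iterateFrobenius k p n).surjective)
    exact RingHom.finiteType_algebraMap.mpr
      (inferInstanceAs (Algebra.FiniteType k (MvPolynomial (Fin s) k)))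

/-- With `E` the separable closure of the fraction field in `K`, the power map `a ↦ a^(p^n)` carries
`K` into `E` for one fixed `n`. It embeds the integral closure in `K` into that in `E`, which is
finite over `P` by separability. The embedding is linear over the `n`-th Frobenius of `P`, a finite
map. -/
theorem finite_integralClosure_of_finite_frobenius {P K : Type*} [CommRing P] [IsDomain P]
    [IsIntegrallyClosed P] [IsNoetherianRing P] (p : ℕ) [ExpChar P p]
    (hP : ∀ n, (iterateFrobenius P p n).Finite) [Field K] [Algebra P K] [Algebra (FractionRing P) K]
    [IsScalarTower P (FractionRing P) K] [FiniteDimensional (FractionRing P) K] :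
    Module.Finite P (integralClosure P K) := by
  let F := FractionRing P
  have hFP : ExpChar F p := expChar_of_injective_algebraMap (IsFractionRing.injective P F) p
  have hKp : ExpChar K p := expChar_of_injective_algebraMap (algebraMap F K).injective p
  let E := separableClosure F K
  have hEp : ExpChar E p := expChar_of_injective_algebraMap (algebraMap F E).injective p
  let n := IsPurelyInseparable.exponent E K
  have hn : ∀ a : K, ∃ e : E, (e : K) = a ^ p ^ n := fun a =>
    IsPurelyInseparable.exponent_def' E p a
  have hfin : Module.Finite P (integralClosure P E) :=
    IsIntegralClosure.finite P F E (integralClosure P E)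
  have : IsScalarTower P E K := IsScalarTower.to₁₃₄ P F E K
  choose e he using hn
  let N := integralClosure P K
  have hint : ∀ a : N, IsIntegral P (e a) := by
    intro a
    rw [← isIntegral_algebraMap_iff (algebraMap E K).injective]
    change IsIntegral P ((e a : E) : K)
    rw [he]
    exact IsIntegral.pow a.2 _
  have hEinj : Function.Injective (algebraMap E K) := (algebraMap E K).injective
  let g : N →+* integralClosure P E :=
    { toFun := fun a => ⟨e a, hint a⟩
      map_one' := Subtype.ext (hEinj (by change ((e _ : E) : K) = _; rw [he]; simp))
      map_zero' := Subtype.ext (hEinj (by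
        change ((e _ : E) : K) = _
        rw [he]; simp [(expChar_pos K p).ne']))
      map_mul' := fun a c => Subtype.ext (hEinj (by
        change ((e _ : E) : K) = ((e _ : E) : K) * ((e _ : E) : K)
        simp only [he]; simp [mul_pow]))
      map_add' := fun a c => Subtype.ext (hEinj (by
        change ((e _ : E) : K) = ((e _ : E) : K) + ((e _ : E) : K)
        simp only [he]
        simpa using add_pow_expChar_pow (a : K) (c : K) p n)) }
  have hg : Function.Injective g := by
    intro a c hac
    have : ((e a : E) : K) = ((e c : E) : K) := congrArg (fun t => ((t.1 : E) : K)) hac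
    rw [he, he] at this
    exact Subtype.ext (iterateFrobenius_inj K p n this)
  have hcomp : g.comp (algebraMap P N) = (algebraMap P (integralClosure P E)).comp
      (iterateFrobenius P p n) := by
    refine RingHom.ext fun a => Subtype.ext (hEinj ?_)
    change ((e _ : E) : K) = algebraMap E K (algebraMap P E _)
    rw [he, ← IsScalarTower.algebraMap_apply, iterateFrobenius_def, map_pow]
    rfl
  have hfin' : (algebraMap P (integralClosure P E)).Finite := RingHom.finite_algebraMap.mpr hfin
  exact RingHom.finite_algebraMap.mp
    (finite_of_comp_of_injective _ g hg (hcomp ▸ hfin'.comp (hP n)))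

/-- Noether normalization reduces this to the integral closure of a polynomial ring in a finite
extension of its fraction field. -/
theorem finite_integralClosure_of_finiteType (k : Type*) [Field k] [PerfectField k] {A K : Type*}
    [CommRing A] [IsDomain A] [Algebra k A] [Algebra.FiniteType k A] [Field K] [Algebra A K]
    [IsFractionRing A K] : Module.Finite A (integralClosure A K) := by
  obtain ⟨s, g, hg, hfin⟩ := exists_finite_inj_algHom_of_fg k A
  let P := MvPolynomial (Fin s) k
  let : Algebra P A := g.toRingHom.toAlgebra
  have : Module.Finite P A := hfin
  have hPA : FaithfulSMul P A := (faithfulSMul_iff_algebraMap_injective P A).mpr hg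
  let : Algebra P K := ((algebraMap A K).comp (algebraMap P A)).toAlgebra
  have : IsScalarTower P A K := IsScalarTower.of_algebraMap_eq fun _ => rfl
  have : FaithfulSMul P K := (faithfulSMul_iff_algebraMap_injective P K).mpr
    ((IsFractionRing.injective A K).comp hg)
  let : Algebra (FractionRing P) K := FractionRing.liftAlgebra P K
  have : IsScalarTower P (FractionRing P) K := FractionRing.isScalarTower_liftAlgebra P K
  have : Algebra.IsIntegral P A := Algebra.IsIntegral.of_finite P A
  have : FiniteDimensional (FractionRing P) K := .of_isLocalization P A (nonZeroDivisors P)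
  obtain ⟨p, hp⟩ := ExpChar.exists k
  have : ExpChar P p := expChar_of_injective_algebraMap (algebraMap k P).injective p
  have : PerfectRing k p := PerfectField.toPerfectRing p
  have hN := finite_integralClosure_of_finite_frobenius (P := P) (K := K) p
    (iterateFrobenius_mvPolynomial_finite p s)
  let f : integralClosure P K →ₗ[P] integralClosure A K :=
    { toFun := fun a => ⟨a, IsIntegral.tower_top a.2⟩
      map_add' := fun _ _ => rfl
      map_smul' := fun r a => Subtype.ext (by simp) }
  have hf : Function.Surjective f := fun a =>
    ⟨⟨a, isIntegral_trans (R := P) (A := A) _ a.2⟩, rfl⟩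
  have := Module.Finite.of_surjective f hf
  exact Module.Finite.of_restrictScalars_finite P A _

/-- `C` is a localization of a finitely generated algebra `A`. An element integral over `C` becomes
integral over `A` after multiplication by a denominator, which is a unit of `C`; so generators of
the integral closure of `A` suffice. -/
theorem finite_normalization (k : Type*) [Field k] [PerfectField k] (C : Type*)
    [CommRing C] [IsDomain C] [Algebra k C] [Algebra.EssFiniteType k C] :
    Module.Finite C (Normalization C) := by
  let A := Algebra.EssFiniteType.subalgebra k C
  let S := Algebra.EssFiniteType.submonoid k C
  let K := FractionRing C
  have hinj : Function.Injective (algebraMap A K) :=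
    (IsFractionRing.injective C K).comp Subtype.val_injective
  have : FaithfulSMul A K := (faithfulSMul_iff_algebraMap_injective A K).mpr hinj
  have hAK : IsFractionRing A K := IsFractionRing.of_field _ _ (fun z => by
    obtain ⟨c, d, hd, rfl⟩ := IsFractionRing.div_surjective (A := C) z
    obtain ⟨x, s, rfl⟩ := IsLocalization.exists_mk'_eq S c
    obtain ⟨y, t, rfl⟩ := IsLocalization.exists_mk'_eq S d
    refine ⟨x * t, y * s, ?_⟩
    have hs := congrArg (algebraMap C K) (IsLocalization.mk'_spec C x s)
    have ht := congrArg (algebraMap C K) (IsLocalization.mk'_spec C y t)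
    rw [map_mul, ← IsScalarTower.algebraMap_apply, ← IsScalarTower.algebraMap_apply] at hs ht
    have hs0 : algebraMap A K s ≠ 0 := fun h0 => by
      have h1 := IsLocalization.map_units C s
      have h2 : algebraMap C K (algebraMap A C s) = 0 := by
        rw [← IsScalarTower.algebraMap_apply]; exact h0
      exact (h1.map (algebraMap C K)).ne_zero h2
    have ht0 : algebraMap A K t ≠ 0 := fun h0 => by
      have h1 := IsLocalization.map_units C t
      have h2 : algebraMap C K (algebraMap A C t) = 0 := by
        rw [← IsScalarTower.algebraMap_apply]; exact h0
      exact (h1.map (algebraMap C K)).ne_zero h2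
    have hd0 : algebraMap C K (IsLocalization.mk' C y t) ≠ 0 :=
      IsFractionRing.to_map_ne_zero_of_mem_nonZeroDivisors hd
    rw [map_mul, map_mul, ← hs, ← ht, div_eq_div_iff hd0 (mul_ne_zero (mul_ne_zero hd0 ht0) hs0)]
    ring)
  obtain ⟨T, hT⟩ := (finite_integralClosure_of_finiteType k (A := A) (K := K)).fg_top
  let f : integralClosure A K →ₗ[A] Normalization C :=
    { toFun := fun a => ⟨a, IsIntegral.tower_top a.2⟩
      map_add' := fun _ _ => rfl
      map_smul' := fun r a => Subtype.ext (by simp) }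
  classical
  refine ⟨⟨T.image f, ?_⟩⟩
  rw [eq_top_iff]
  rintro a -
  obtain ⟨s, hs⟩ := IsIntegral.exists_multiple_integral_of_isLocalization S (a : K) a.2
  have h1 : f ⟨s • (a : K), hs⟩ ∈ Submodule.span C (T.image f : Set (Normalization C)) := by
    have h2 : f ⟨s • (a : K), hs⟩ ∈ (⊤ : Submodule A (integralClosure A K)).map f :=
      Submodule.mem_map_of_mem trivial
    rw [← hT, Submodule.map_span] at h2
    rw [Finset.coe_image]
    exact Submodule.span_le_restrictScalars A C _ h2
  obtain ⟨v, hv⟩ := (IsLocalization.map_units C s).exists_left_inv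
  have h3 : a = v • f ⟨s • (a : K), hs⟩ := by
    apply Subtype.ext
    change (a : K) = v • (s • (a : K))
    rw [Submonoid.smul_def, Algebra.smul_def, Algebra.smul_def,
      IsScalarTower.algebraMap_apply A C K, ← mul_assoc, ← map_mul, hv, map_one, one_mul]
  rw [h3]
  exact Submodule.smul_mem _ _ h1

end FiniteNormalization

/-! ### Expansion in a formal parameter. -/

section FormalParameter

variable {k : Type*} [Field k] {N : Type*} [CommRing N] [IsLocalRing N] [Algebra k N]
  (z : PowerSeries k ≃ₐ[k] AdicCompletion (maximalIdeal N) N)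

/-- The expansion of a function in powers of the formal parameter. -/
def expansion : N →ₐ[k] PowerSeries k :=
  (z.symm : AdicCompletion (maximalIdeal N) N →ₐ[k] PowerSeries k).comp
    ((Algebra.ofId N (AdicCompletion (maximalIdeal N) N)).restrictScalars k)

theorem z_expansion (a : N) : z (expansion z a) = algebraMap N _ a :=
  z.apply_symm_apply _

/-- The isomorphism `z` is only algebraic, with no continuity assumed. Both conditions define the
kernel of a surjection from `k⟦z⟧` onto a field, and `k⟦z⟧` has a single maximal ideal. -/
theorem evalₐ_one_eq_zero_iff (g : AdicCompletion (maximalIdeal N) N) :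
    AdicCompletion.evalₐ (maximalIdeal N) 1 g = 0 ↔ PowerSeries.constantCoeff (z.symm g) = 0 := by
  let f : PowerSeries k →+* N ⧸ maximalIdeal N ^ 1 :=
    (AdicCompletion.evalₐ (maximalIdeal N) 1 : AdicCompletion (maximalIdeal N) N →+* _).comp
      (z : PowerSeries k →+* AdicCompletion (maximalIdeal N) N)
  have hf : Function.Surjective f :=
    (AdicCompletion.surjective_evalₐ (maximalIdeal N) 1).comp z.surjective
  have hmax : (maximalIdeal N ^ 1).IsMaximal := by rw [pow_one]; infer_instance
  let : Field (N ⧸ maximalIdeal N ^ 1) := Ideal.Quotient.field _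
  have hk : RingHom.ker f = maximalIdeal (PowerSeries k) :=
    IsLocalRing.eq_maximalIdeal (RingHom.ker_isMaximal_of_surjective f hf)
  have h1 : AdicCompletion.evalₐ (maximalIdeal N) 1 g = 0 ↔ z.symm g ∈ RingHom.ker f := by
    rw [RingHom.mem_ker]
    change _ ↔ AdicCompletion.evalₐ (maximalIdeal N) 1 (z (z.symm g)) = 0
    rw [z.apply_symm_apply]
  rw [h1, hk, ← PowerSeries.ker_coeff_eq_max_ideal, RingHom.mem_ker]

theorem mem_maximalIdeal_iff_expansion (a : N) :
    a ∈ maximalIdeal N ↔ PowerSeries.constantCoeff (expansion z a) = 0 := by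
  have h := evalₐ_one_eq_zero_iff z (algebraMap N _ a)
  change _ ↔ PowerSeries.constantCoeff (expansion z a) = 0 at h
  rw [← h, AlgHom.commutes, Ideal.Quotient.algebraMap_eq, Ideal.Quotient.eq_zero_iff_mem, pow_one]

theorem sub_mem_maximalIdeal (a : N) :
    a - algebraMap k N (PowerSeries.constantCoeff (expansion z a)) ∈ maximalIdeal N := by
  rw [mem_maximalIdeal_iff_expansion z, map_sub, AlgHom.commutes]
  simp

theorem exists_sub_mul_mem_sq {u w : N} (hu : u ∈ maximalIdeal N)
    (hu1 : PowerSeries.coeff 1 (expansion z u) ≠ 0) (hw : w ∈ maximalIdeal N) :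
    ∃ h : N, w - u * h ∈ maximalIdeal N ^ 2 := by
  rw [mem_maximalIdeal_iff_expansion z, ← PowerSeries.X_dvd_iff] at hu hw
  obtain ⟨U, hU⟩ := hu
  obtain ⟨W, hW⟩ := hw
  have hU0 : PowerSeries.constantCoeff U ≠ 0 := by
    rw [hU, show 1 = 0 + 1 from rfl, PowerSeries.coeff_succ_X_mul] at hu1
    simpa using hu1
  obtain ⟨h, hh⟩ := Ideal.Quotient.mk_surjective
    (AdicCompletion.evalₐ (maximalIdeal N) 2 (z (U⁻¹ * W)))
  refine ⟨h, ?_⟩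
  rw [← Ideal.Quotient.eq, map_mul, hh]
  have e : ∀ a : N, Ideal.Quotient.mk (maximalIdeal N ^ 2) a =
      AdicCompletion.evalₐ (maximalIdeal N) 2 (z (expansion z a)) := fun a => by
    rw [z_expansion, AlgHom.commutes, Ideal.Quotient.algebraMap_eq]
  rw [e, e, ← map_mul, ← map_mul, hU, hW, mul_assoc, ← mul_assoc U, PowerSeries.mul_inv_cancel _ hU0,
    one_mul]

/-- A series of order 1 divides every series without constant term. The quotient is approximated in
`N` modulo `𝔪²`, and Nakayama applies. -/
theorem maximalIdeal_eq_span_of_coeff_one_ne_zero [IsNoetherianRing N] {u : N}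
    (hu : u ∈ maximalIdeal N) (hu1 : PowerSeries.coeff 1 (expansion z u) ≠ 0) :
    maximalIdeal N = Ideal.span {u} := by
  apply le_antisymm
  · refine Submodule.le_of_le_smul_of_le_jacobson_bot (I := maximalIdeal N)
      (IsNoetherian.noetherian _) (IsLocalRing.maximalIdeal_le_jacobson _) ?_
    intro w hw
    obtain ⟨h, hh⟩ := exists_sub_mul_mem_sq z hu hu1 hw
    rw [← add_sub_cancel (u * h) w]
    refine add_mem (Ideal.mem_sup_left ?_) (Ideal.mem_sup_right ?_)
    · exact Ideal.mul_mem_right _ _ (Ideal.mem_span_singleton_self u)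
    · rwa [smul_eq_mul, ← sq]
  · rwa [Ideal.span_singleton_le_iff_mem]

/-- This replaces continuity of `z.symm`. The evaluation kernels are ideals of a discrete valuation
ring with zero intersection; if none of them were contained in `(X^d)`, each would contain `X^d`. -/
theorem exists_evalₐ_eq_zero_imp_dvd (d : ℕ) : ∃ n, ∀ g : AdicCompletion (maximalIdeal N) N,
    AdicCompletion.evalₐ (maximalIdeal N) n g = 0 → PowerSeries.X ^ d ∣ z.symm g := by
  by_contra! hc
  have key : ∀ n, AdicCompletion.evalₐ (maximalIdeal N) n (z (PowerSeries.X ^ d)) = 0 := by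
    intro n
    obtain ⟨g, hg, hd⟩ := hc n
    obtain h0 | h0 := eq_or_ne (z.symm g) 0
    · rw [h0] at hd; exact absurd (dvd_zero _) hd
    obtain ⟨l, V, hV, hgV⟩ : ∃ l V, IsUnit V ∧ z.symm g = PowerSeries.X ^ l * V := by
      obtain ⟨l, hl⟩ := IsDiscreteValuationRing.associated_pow_irreducible h0
        (PowerSeries.X_irreducible (R := k))
      obtain ⟨V, hV⟩ := hl.symm
      exact ⟨l, V, V.isUnit, hV.symm⟩
    have hl : l ≤ d := by
      by_contra! hl
      exact hd (hgV ▸ (pow_dvd_pow _ hl.le).mul_right V)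
    obtain ⟨V', hV'⟩ := hV.exists_right_inv
    have : z (PowerSeries.X ^ d) = g * z (V' * PowerSeries.X ^ (d - l)) := by
      rw [← z.apply_symm_apply g, ← map_mul, hgV, ← pow_sub_mul_pow (PowerSeries.X : PowerSeries k) hl]
      congr 1
      linear_combination -(PowerSeries.X ^ (d - l) * PowerSeries.X ^ l) * hV'
    rw [this, map_mul, hg, zero_mul]
  have h0 : z (PowerSeries.X ^ d) = 0 := by
    apply AdicCompletion.ext_evalₐ
    intro n
    rw [key, map_zero]
  rw [map_eq_zero_iff _ z.injective] at h0
  exact pow_ne_zero d PowerSeries.X_ne_zero h0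

end FormalParameter

/-! ### A unibranch curve with a function of order one. -/

section Curve

variable {k : Type*} [Field k] [PerfectField k] {C : Type*} [CommRing C] [IsDomain C]
  [IsLocalRing C] [Algebra k C] [Algebra.EssFiniteType k C] [IsLocalRing (Normalization C)]

instance faithfulSMul_normalization : FaithfulSMul C (Normalization C) :=
  (faithfulSMul_iff_algebraMap_injective _ _).mpr fun _ _ h =>
    IsFractionRing.injective C (FractionRing C) (congrArg Subtype.val h)

/-- The image of `c` generates the maximal ideal of the normalization, whose residue field is `k`.
So the normalization is `C + 𝔪_C · Normalization C`, and by finiteness Nakayama makes it equal to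
`C`. -/
theorem maximalIdeal_eq_span_of_expansion
    (z : PowerSeries k ≃ₐ[k]
      AdicCompletion (maximalIdeal (Normalization C)) (Normalization C))
    {c : C} (hc : c ∈ maximalIdeal C)
    (h1 : PowerSeries.coeff 1 (expansion z (algebraMap C (Normalization C) c)) ≠ 0) :
    maximalIdeal C = Ideal.span {c} := by
  have hN := finite_normalization k C
  have hC : IsNoetherianRing C := Algebra.EssFiniteType.isNoetherianRing k C
  have : IsNoetherianRing (Normalization C) := IsNoetherianRing.of_finite C _
  have hmem : ∀ d ∈ maximalIdeal C, algebraMap C (Normalization C) d ∈ maximalIdeal _ := by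
    intro d hd
    rw [mem_maximalIdeal, mem_nonunits_iff] at hd ⊢
    exact fun h => hd (isUnit_of_map_unit (algebraMap C (Normalization C)) _ h)
  have hmax := maximalIdeal_eq_span_of_coeff_one_ne_zero z (hmem c hc) h1
  have hsurj : Function.Surjective (algebraMap C (Normalization C)) := by
    have htop : (⊤ : Submodule C (Normalization C)) ≤
        LinearMap.range (Algebra.linearMap C (Normalization C)) := by
      refine Submodule.le_of_le_smul_of_le_jacobson_bot (I := maximalIdeal C)
        hN.fg_top (IsLocalRing.maximalIdeal_le_jacobson _) ?_
      intro a _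
      rw [← add_sub_cancel (algebraMap k (Normalization C)
        (PowerSeries.constantCoeff (expansion z a))) a]
      refine add_mem (Submodule.mem_sup_left ?_) (Submodule.mem_sup_right ?_)
      · exact ⟨algebraMap k C _, (IsScalarTower.algebraMap_apply k C (Normalization C) _).symm⟩
      · have := sub_mem_maximalIdeal z a
        rw [hmax, Ideal.mem_span_singleton] at this
        obtain ⟨v, hv⟩ := this
        rw [hv, ← Algebra.smul_def]
        exact Submodule.smul_mem_smul hc trivial
    exact fun a => htop (Submodule.mem_top (x := a))
  apply le_antisymm
  · intro d hd
    have := hmem d hd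
    rw [hmax, Ideal.mem_span_singleton] at this
    obtain ⟨v, hv⟩ := this
    obtain ⟨v, rfl⟩ := hsurj v
    rw [← map_mul] at hv
    rw [FaithfulSMul.algebraMap_injective C (Normalization C) hv]
    exact Ideal.mul_mem_right _ _ (Ideal.mem_span_singleton_self c)
  · rwa [Ideal.span_singleton_le_iff_mem]

end Curve

/-! ### Low-order coefficients of products. -/

section PowerSeries

variable {k : Type*} [Field k]

/-- Replacing `R` by its constant term changes the product by `(R - e) F`, which has order at least
`2r`. -/
theorem coeff_mul_of_dvd {r c : ℕ} (hc : c < 2 * r) {e : k} {R F : PowerSeries k}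
    (hR : PowerSeries.X ^ r ∣ R - PowerSeries.C e) (hF : PowerSeries.X ^ r ∣ F) :
    PowerSeries.coeff c (R * F) = e * PowerSeries.coeff c F := by
  have h : PowerSeries.X ^ (2 * r) ∣ (R - PowerSeries.C e) * F := by
    rw [two_mul, pow_add]; exact mul_dvd_mul hR hF
  rw [PowerSeries.X_pow_dvd_iff] at h
  have := h c hc
  rw [sub_mul, map_sub, PowerSeries.coeff_C_mul, sub_eq_zero] at this
  exact this

theorem coeff_five_mul {R F : PowerSeries k} (hR : PowerSeries.coeff 1 R = 0)
    (hF : PowerSeries.X ^ 4 ∣ F) :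
    PowerSeries.coeff 5 (R * F) = PowerSeries.coeff 0 R * PowerSeries.coeff 5 F := by
  rw [PowerSeries.X_pow_dvd_iff] at hF
  simp [PowerSeries.coeff_mul, Finset.Nat.antidiagonal_succ, hR, hF 0, hF 1, hF 2, hF 3]

theorem coeff_five_mul_of_sq_dvd {F G : PowerSeries k} (hF : PowerSeries.X ^ 2 ∣ F)
    (hG : PowerSeries.X ^ 2 ∣ G) : PowerSeries.coeff 5 (F * G) =
      PowerSeries.coeff 2 F * PowerSeries.coeff 3 G +
        PowerSeries.coeff 3 F * PowerSeries.coeff 2 G := by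
  rw [PowerSeries.X_pow_dvd_iff] at hF hG
  simp [PowerSeries.coeff_mul, Finset.Nat.antidiagonal_succ, hF 0, hF 1, hG 0, hG 1]

end PowerSeries

/-! ### Tangent vectors, formal curves and the Hessian. -/

namespace LocalCoords

variable {k O ι : Type*} [Field k] [CommRing O] [IsLocalRing O] [Algebra k O] [Fintype ι]
  [DecidableEq ι] (X : LocalCoords k O ι)

/-- The derivative at the closed point in the direction of a tangent vector. -/
def tangent (v : ι → k) : O →ₗ[k] k := X.ε.toLinearMap ∘ₗ (X.field v : O →ₗ[k] O)

theorem tangent_apply (v : ι → k) (g : O) : X.tangent v g = X.ε (X.field v g) := rfl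

theorem tangent_eq_sum (v : ι → k) (g : O) : X.tangent v g = ∑ i, v i * X.ε (X.D i g) := by
  simp [tangent_apply, field_apply]

theorem tangent_mul (v : ι → k) (g h : O) :
    X.tangent v (g * h) = X.ε g * X.tangent v h + X.ε h * X.tangent v g := by
  simp [tangent_apply]

theorem tangent_x (v : ι → k) (i : ι) : X.tangent v (X.x i) = v i := by
  simp [tangent_apply, field_x]

theorem tangent_algebraMap (v : ι → k) (r : k) : X.tangent v (algebraMap k O r) = 0 := by
  simp [tangent_apply]

theorem tangent_add (v w : ι → k) : X.tangent (v + w) = X.tangent v + X.tangent w := by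
  ext g; simp [tangent_apply, field_add]

theorem tangent_smul (r : k) (v : ι → k) : X.tangent (r • v) = r • X.tangent v := by
  ext g; simp [tangent_apply, field_smul]

/-- Functions vanishing to first order along a tangent vector. -/
def tangentIdeal (v : ι → k) : Ideal O where
  carrier := {g | X.ε g = 0 ∧ X.tangent v g = 0}
  zero_mem' := by simp
  add_mem' := by
    rintro a c ⟨h1, h2⟩ ⟨h3, h4⟩
    simp [h1, h2, h3, h4]
  smul_mem' := by
    rintro c a ⟨h1, h2⟩
    simp [tangent_mul, h1, h2]

theorem mem_tangentIdeal {v : ι → k} {g : O} :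
    g ∈ X.tangentIdeal v ↔ X.ε g = 0 ∧ X.tangent v g = 0 := Iff.rfl

theorem mem_sq_of_ε_D_eq_zero {g : O} (hg : X.ε g = 0) (hD : ∀ i, X.ε (X.D i g) = 0) :
    g ∈ maximalIdeal O ^ 2 := by
  obtain ⟨r, rfl⟩ := X.exists_eq_sum (X.ε_eq_zero_iff.mp hg)
  rw [sq]
  refine sum_mem fun i _ => Ideal.mul_mem_mul ?_ (X.x_mem i)
  have := hD i
  rw [map_sum] at this
  simpa [X.D_x, X.ε_x, apply_ite X.ε, ← X.ε_eq_zero_iff] using this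

section Curve

variable (χ : O →ₐ[k] PowerSeries k)

/-- The coefficient vector of degree `c` of a formal curve. -/
def curveCoeff (c : ℕ) (i : ι) : k := PowerSeries.coeff c (χ (X.x i))

omit [Fintype ι] in
theorem dvd_sub_C {r : ℕ} (hr : ∀ g ∈ maximalIdeal O, PowerSeries.X ^ r ∣ χ g) (g : O) :
    PowerSeries.X ^ r ∣ χ g - PowerSeries.C (X.ε g) := by
  have := hr (g - algebraMap k O (X.ε g)) (by rw [← X.ε_eq_zero_iff]; simp)
  rwa [map_sub, AlgHom.commutes, PowerSeries.algebraMap_eq] at this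

/-- Along a curve of order `r`, products of two functions vanishing at the point first contribute in
degree `2r`, so lower coefficients depend on `g` only to first order. -/
theorem coeff_eq_tangent {r c : ℕ} (hr : ∀ g ∈ maximalIdeal O, PowerSeries.X ^ r ∣ χ g)
    (hc0 : 0 < c) (hc : c < 2 * r) (g : O) :
    PowerSeries.coeff c (χ g) = X.tangent (X.curveCoeff χ c) g := by
  obtain ⟨s, hs⟩ := X.exists_eq_add_sum g
  rw [hs, map_add, map_add, map_add, tangent_algebraMap, AlgHom.commutes,
    PowerSeries.algebraMap_eq, PowerSeries.coeff_C, if_neg hc0.ne', map_sum, map_sum, map_sum]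
  congr 1
  refine Finset.sum_congr rfl fun i _ => ?_
  rw [map_mul, coeff_mul_of_dvd hc (X.dvd_sub_C χ hr _) (hr _ (X.x_mem i)), tangent_mul, X.ε_x,
    tangent_x, zero_mul, add_zero, curveCoeff]

/-- For curves of order 2, the degree 5 part of a product of two functions vanishing at the point
comes only from `2 + 3` and `3 + 2`. -/
theorem coeff_five_eq (h2 : ∀ g ∈ maximalIdeal O, PowerSeries.X ^ 2 ∣ χ g) {g : O}
    (hg : g ∈ maximalIdeal O ^ 2) : PowerSeries.coeff 5 (χ g) =
      X.tangent (X.curveCoeff χ 2) (X.field (X.curveCoeff χ 3) g) := by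
  rw [sq] at hg
  induction hg using Submodule.mul_induction_on' with
  | mem_mul_mem u hu v hv =>
    have hu0 := X.ε_eq_zero_iff.mpr hu
    have hv0 := X.ε_eq_zero_iff.mpr hv
    rw [map_mul, coeff_five_mul_of_sq_dvd (h2 u hu) (h2 v hv),
      X.coeff_eq_tangent χ h2 (by norm_num) (by norm_num),
      X.coeff_eq_tangent χ h2 (by norm_num) (by norm_num),
      X.coeff_eq_tangent χ h2 (by norm_num) (by norm_num),
      X.coeff_eq_tangent χ h2 (by norm_num) (by norm_num)]
    simp only [Derivation.leibniz, smul_eq_mul, map_add, tangent_mul, hu0, hv0]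
    simp only [tangent_apply]
    ring
  | add u _ v _ hu hv => rw [map_add, map_add, map_add, map_add, hu, hv]

end Curve

section Hessian

variable [IsNoetherianRing O] [CharP k 2] (f : O)

/-- The Hessian of `f` at the closed point. -/
def hessian : LinearMap.BilinForm k (ι → k) :=
  LinearMap.mk₂ k (fun c d => X.tangent c (X.field d f))
    (by intro c c' d; simp [tangent_add])
    (by intro r c d; simp [tangent_smul])
    (by intro c d d'; simp [field_add])
    (by intro r c d; simp [field_smul])

omit [IsNoetherianRing O] [CharP k 2] in
theorem hessian_apply (c d : ι → k) : X.hessian f c d = X.tangent c (X.field d f) := rfl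

omit [CharP k 2] in
theorem hessian_symm (c d : ι → k) : X.hessian f c d = X.hessian f d c := by
  simp only [hessian_apply, tangent_apply, X.field_comm c d]

theorem hessian_isAlt : (X.hessian f).IsAlt := fun c => by
  rw [hessian_apply, tangent_apply, field_field_self, map_zero]

variable {f}

/-- An alternating form on an even-dimensional space has an even-dimensional kernel, so a nonzero
kernel is at least a plane. -/
theorem two_le_finrank_ker_hessian (hι : Even (Fintype.card ι))
    (hf : ∀ i, X.ε (X.D i f) = 0) (hH : HessianDegenerate k f) :
    2 ≤ Module.finrank k (LinearMap.ker (X.hessian f)) := by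
  obtain ⟨r, hr, h⟩ := even_finrank_sub_finrank_ker_of_isAlt (X.hessian f) (X.hessian_isAlt f)
  rw [Module.finrank_pi, Fintype.card] at h
  have heven : Even (Module.finrank k (LinearMap.ker (X.hessian f))) := by
    rw [Fintype.card, h] at hι
    exact (Nat.even_add.mp hι).mp hr
  suffices hne : Module.finrank k (LinearMap.ker (X.hessian f)) ≠ 0 by
    obtain ⟨t, ht⟩ := heven; omega
  rw [Ne, Submodule.finrank_eq_zero]
  intro hbot
  obtain ⟨θ, ⟨h, hh⟩, hθ⟩ := hH
  have hres : ∀ g : O, residue O g = 0 ↔ X.ε g = 0 := fun g => by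
    rw [residue_eq_zero_iff, X.ε_eq_zero_iff]
  -- The value at `p` of the degenerate vector field. As `f` is critical at `p`, derivatives of the
  -- coefficients of the field do not contribute, and `c` lies in the kernel.
  let c : ι → k := fun i => X.ε (θ (X.x i))
  have hexp : ∀ g, θ g = ∑ i, X.D i g * θ (X.x i) := fun g => X.derivation_apply θ g
  have hc : c ∈ LinearMap.ker (X.hessian f) := by
    rw [LinearMap.mem_ker]
    refine LinearMap.ext fun d => ?_
    have h1 := (hres _).mp (hθ (X.field d))
    rw [hexp, map_sum, map_sum] at h1
    rw [hessian_symm, hessian_apply, field_apply, map_sum, LinearMap.zero_apply, ← h1]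
    refine Finset.sum_congr rfl fun i _ => ?_
    simp only [map_smul, Derivation.leibniz, smul_eq_mul, map_add, map_mul, hf, zero_mul, zero_add,
      tangent_apply, c]
  rw [hbot, Submodule.mem_bot] at hc
  apply hh
  rw [hres, hexp, map_sum]
  refine Finset.sum_eq_zero fun i _ => ?_
  rw [map_mul]
  have : X.ε (θ (X.x i)) = 0 := congrFun hc i
  rw [this, mul_zero]

/-- Expanding in a basis of the plane `K`, every triple product repeats one of two commuting fields,
each of square zero. -/
theorem field_field_field_eq_zero {K : Submodule k (ι → k)} (hK : Module.finrank k K = 2)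
    {a b c : ι → k} (ha : a ∈ K) (hb : b ∈ K) (hc : c ∈ K) (g : O) :
    X.field a (X.field b (X.field c g)) = 0 := by
  let B := Module.finBasisOfFinrankEq k K hK
  have hB : ∀ v ∈ K, ∃ s t : k, v = s • (B 0 : ι → k) + t • (B 1 : ι → k) := by
    intro v hv
    have := B.sum_repr ⟨v, hv⟩
    rw [Fin.sum_univ_two] at this
    exact ⟨_, _, (congrArg Subtype.val this).symm⟩
  obtain ⟨a0, a1, rfl⟩ := hB a ha
  obtain ⟨b0, b1, rfl⟩ := hB b hb
  obtain ⟨c0, c1, rfl⟩ := hB c hc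
  have h0 : ∀ g, X.field (B 0 : ι → k) (X.field (B 1 : ι → k) g) =
      X.field (B 1 : ι → k) (X.field (B 0 : ι → k) g) := X.field_comm _ _
  simp [field_add, field_smul, X.field_field_self, h0]

omit [IsNoetherianRing O] [CharP k 2] in
-- In finite dimension the range of a transpose is the annihilator of the kernel; reflexivity turns
-- the preimage into a vector.
theorem exists_hessian_eq {u : Module.Dual k (ι → k)}
    (hu : ∀ c ∈ LinearMap.ker (X.hessian f), u c = 0) : ∃ ξ, ∀ c, X.hessian f c ξ = u c := by
  have h1 : u ∈ LinearMap.range (X.hessian f).dualMap := by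
    rw [LinearMap.range_dualMap_eq_dualAnnihilator_ker, Submodule.mem_dualAnnihilator]
    exact hu
  obtain ⟨Ψ, hΨ⟩ := h1
  obtain ⟨ξ, rfl⟩ := (Module.evalEquiv k (ι → k)).surjective Ψ
  refine ⟨ξ, fun c => ?_⟩
  rw [← hΨ]
  rfl

end Hessian

end LocalCoords

/-! ### Tangent spaces of sections of `𝒞` and formal curves in them. -/

section LinearSystem

variable {k O : Type*} [Field k] [CommRing O] [IsLocalRing O] [Algebra k O] {m : ℕ}
  {M : Type*} [AddCommGroup M] [Module k M] {φ : M →ₗ[k] O} {b : Module.Basis (Fin (m + 1)) k M}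
  {ι : Type*} [DecidableEq ι] [Fintype ι] (X : LocalCoords k O ι)

theorem tangent_germ_algebraMap (ξ : ι → k) (η : Fin m → k) (a : O) :
    (X.germ m).tangent (Sum.elim ξ η) (algebraMap O _ a) = X.tangent ξ a := by
  simp [LocalCoords.tangent_eq_sum]

theorem tangent_germ_coordY (ξ : ι → k) (η : Fin m → k) (i : Fin m) :
    (X.germ m).tangent (Sum.elim ξ η) (coordY O i) = η i :=
  (X.germ m).tangent_x _ (Sum.inr i)

theorem tangent_germ_universalEq (ξ : ι → k) (η : Fin m → k) :
    (X.germ m).tangent (Sum.elim ξ η) (universalEq φ b) =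
      X.tangent ξ (φ (b 0)) + ∑ i, η i * X.ε (φ (b i.succ)) := by
  simp [universalEq_eq, LocalCoords.tangent_mul, tangent_germ_algebraMap, tangent_germ_coordY,
    mul_comm]

theorem tangent_germ_universalEqDeriv (ξ : ι → k) (η : Fin m → k) (E : Derivation k O O) :
    (X.germ m).tangent (Sum.elim ξ η) (universalEqDeriv φ b E) =
      X.tangent ξ (E (φ (b 0))) + ∑ i, η i * X.ε (E (φ (b i.succ))) := by
  simp [universalEqDeriv, LocalCoords.tangent_mul, tangent_germ_algebraMap, tangent_germ_coordY,
    mul_comm]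

omit [Fintype ι] in
theorem ε_universalEq : (X.germ m).ε (universalEq φ b) = X.ε (φ (b 0)) := by
  simp [universalEq_eq]

omit [Fintype ι] in
theorem ε_universalEqDeriv (E : Derivation k O O) :
    (X.germ m).ε (universalEqDeriv φ b E) = X.ε (E (φ (b 0))) := by
  simp [universalEqDeriv]

theorem universalEqDeriv_field (c : ι → k) :
    universalEqDeriv φ b (X.field c) = ∑ i, c i • universalEqDeriv φ b (X.D i) := by
  simp only [universalEqDeriv, smul_add, Finset.sum_add_distrib, X.field_apply, map_sum,
    Finset.mul_sum, Finset.smul_sum]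
  congr 1
  · refine Finset.sum_congr rfl fun i _ => ?_
    rw [← IsScalarTower.coe_toAlgHom' k O, map_smul]
  · rw [Finset.sum_comm]
    refine Finset.sum_congr rfl fun i _ => Finset.sum_congr rfl fun j _ => ?_
    rw [← IsScalarTower.coe_toAlgHom' k O, map_smul, mul_smul_comm]

/-- The pull-back of the affine equation of a linear form vanishing at the origin. -/
def linearEq (O : Type*) [CommRing O] [IsLocalRing O] [Algebra k O]
    (b : Module.Basis (Fin (m + 1)) k M) (l : Module.Dual k M) : GermRing O m :=
  ∑ i, coordY O i * algebraMap k _ (l (b i.succ))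

theorem map_linearSubspaceIdeal {V : Submodule k M} (hV : b 0 ∈ V) :
    (linearSubspaceIdeal b V).map (pullbackPr₂ k O m) =
      Ideal.span {a | ∃ l : Module.Dual k M, (∀ v ∈ V, l v = 0) ∧ a = linearEq O b l} := by
  rw [linearSubspaceIdeal, Ideal.map_span]
  congr 1
  have key : ∀ l : Module.Dual k M, (∀ v ∈ V, l v = 0) →
      pullbackPr₂ k O m (algebraMap (MvPolynomial (Fin m) k) (GermRing k m)
      (MvPolynomial.C (l (b 0)) +
        ∑ i : Fin m, MvPolynomial.X i * MvPolynomial.C (l (b i.succ)))) = linearEq O b l := by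
    intro l hl
    rw [hl _ hV, pullbackPr₂_algebraMap]
    simp [linearEq, coordY, IsScalarTower.algebraMap_apply k O (GermRing O m),
      algebraMap_germRing_apply]
  ext a
  constructor
  · rintro ⟨_, ⟨l, hl, rfl⟩, rfl⟩
    exact ⟨l, hl, key l hl⟩
  · rintro ⟨l, hl, rfl⟩
    exact ⟨_, ⟨l, hl, rfl⟩, key l hl⟩

theorem linearEq_mem_sectionIdeal {V : Submodule k M} (hV : b 0 ∈ V) {l : Module.Dual k M}
    (hl : ∀ v ∈ V, l v = 0) : linearEq O b l ∈ sectionIdeal φ b V := by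
  refine Ideal.mem_sup_right ?_
  rw [map_linearSubspaceIdeal hV]
  exact Ideal.subset_span ⟨l, hl, rfl⟩

theorem linearSubspaceIdeal_anti {V W : Submodule k M} (h : V ≤ W) :
    linearSubspaceIdeal b W ≤ linearSubspaceIdeal b V :=
  Ideal.span_mono fun _ ⟨l, hl, ha⟩ => ⟨l, fun v hv => hl v (h hv), ha⟩

theorem sectionIdeal_anti {V W : Submodule k M} (h : V ≤ W) :
    sectionIdeal φ b W ≤ sectionIdeal φ b V :=
  sup_le_sup le_rfl (Ideal.map_mono (linearSubspaceIdeal_anti h))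

omit [Fintype ι] in
theorem ε_linearEq (l : Module.Dual k M) : (X.germ m).ε (linearEq O b l) = 0 := by
  simp [linearEq]

theorem tangent_germ_linearEq (ξ : ι → k) (η : Fin m → k) (l : Module.Dual k M) :
    (X.germ m).tangent (Sum.elim ξ η) (linearEq O b l) = l (∑ i, η i • b i.succ) := by
  simp [linearEq, LocalCoords.tangent_mul, tangent_germ_coordY,
    LocalCoords.tangent_algebraMap, mul_comm]

theorem mem_of_forall_dual {V : Submodule k M} {v : M}
    (h : ∀ l : Module.Dual k M, (∀ w ∈ V, l w = 0) → l v = 0) : v ∈ V := by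
  rw [← Subspace.forall_mem_dualAnnihilator_apply_eq_zero_iff]
  intro l hl
  exact h l ((Submodule.mem_dualAnnihilator l).mp hl)

variable [IsNoetherianRing O] (hcrit : critIdeal φ b ≠ ⊤) (hbase : NotBasePoint φ)

section
include hcrit hbase

omit [Fintype ι] [IsNoetherianRing O] in
theorem universalEqDeriv_mem (i : ι) : universalEqDeriv φ b (X.D i) ∈ critIdeal φ b :=
  have ⟨_, hi⟩ := exists_isUnit_phi φ b hcrit hbase
  universalEqDeriv_mem_critIdeal X hi i

omit [Fintype ι] [IsNoetherianRing O] in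
theorem ε_D_phi_zero (i : ι) : X.ε (X.D i (φ (b 0))) = 0 := by
  rw [← ε_universalEqDeriv (m := m), (X.germ m).ε_eq_zero_iff]
  exact critIdeal_le_maximalIdeal φ b hcrit (universalEqDeriv_mem X hcrit hbase i)

omit [IsNoetherianRing O] in
theorem universalEqDeriv_field_mem (c : ι → k) :
    universalEqDeriv φ b (X.field c) ∈ critIdeal φ b := by
  rw [universalEqDeriv_field]
  exact sum_mem fun i _ => Submodule.smul_of_tower_mem _ _ (universalEqDeriv_mem X hcrit hbase i)

/-- The tangent vectors of the section at the origin, by equations. -/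
theorem tangent_sectionIdeal_eq_zero {V : Submodule k M} (hV : b 0 ∈ V) {ξ : ι → k}
    {η : Fin m → k} (h1 : ∑ i, η i • b i.succ ∈ V) (h2 : ∑ i, η i * X.ε (φ (b i.succ)) = 0)
    (h3 : ∀ j, X.tangent ξ (X.D j (φ (b 0))) + ∑ i, η i * X.ε (X.D j (φ (b i.succ))) = 0)
    {g : GermRing O m} (hg : g ∈ sectionIdeal φ b V) :
    (X.germ m).tangent (Sum.elim ξ η) g = 0 := by
  obtain ⟨_, hi⟩ := exists_isUnit_phi φ b hcrit hbase
  suffices h : sectionIdeal φ b V ≤ (X.germ m).tangentIdeal (Sum.elim ξ η) from (h hg).2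
  refine sup_le ((critIdeal_le X hcrit hi).trans (sup_le ?_ ?_)) ?_
  · rw [Ideal.span_singleton_le_iff_mem, LocalCoords.mem_tangentIdeal, ε_universalEq,
      tangent_germ_universalEq, h2, add_zero, X.ε_eq_zero_iff]
    refine ⟨phi_zero_mem φ b hcrit, ?_⟩
    simp [LocalCoords.tangent_eq_sum, ε_D_phi_zero X hcrit hbase]
  · rw [Ideal.span_le]
    rintro _ ⟨j, rfl⟩
    exact ⟨(ε_universalEqDeriv X _).trans (ε_D_phi_zero X hcrit hbase j),
      (tangent_germ_universalEqDeriv X ξ η _).trans (h3 j)⟩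
  · rw [map_linearSubspaceIdeal hV, Ideal.span_le]
    rintro _ ⟨l, hl, rfl⟩
    exact ⟨ε_linearEq X l, (tangent_germ_linearEq X ξ η l).trans (hl _ h1)⟩

/-- With `η = 0` the tangent equations reduce to the Hessian, whatever `V` is. This is applied both
to the surface (`V = L`) and to the curve (`V = Λ`). -/
theorem tangent_ker_hessian {V : Submodule k M} (hV : b 0 ∈ V) {c : ι → k}
    (hc : c ∈ LinearMap.ker (X.hessian (φ (b 0)))) {g : GermRing O m}
    (hg : g ∈ sectionIdeal φ b V) : (X.germ m).tangent (Sum.elim c 0) g = 0 := by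
  refine tangent_sectionIdeal_eq_zero X hcrit hbase hV (by simp) (by simp) (fun j => ?_) hg
  have h := LinearMap.congr_fun (LinearMap.mem_ker.mp hc) (Pi.single j 1)
  rw [LocalCoords.hessian_apply] at h
  have hs : X.field (Pi.single j 1) (φ (b 0)) = X.D j (φ (b 0)) := by
    simp [LocalCoords.field_apply, Pi.single_apply]
  rw [hs] at h
  simpa using h

variable [CharP k 2] (hι : Even (Fintype.card ι)) (hH : HessianDegenerate k (φ (b 0)))
  {L : Submodule k M} (hL : b 0 ∈ L)
  (hS : ∃ s : Fin 2 → GermRing O m, (∀ i, s i ∈ maximalIdeal (GermRing O m)) ∧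
    ∀ g ∈ maximalIdeal (GermRing O m), ∃ r : Fin 2 → GermRing O m,
      g - ∑ i, r i * s i ∈ sectionIdeal φ b L)
include hι hH hL hS

/-- If the section is regular of dimension two, then its tangent space is the kernel of the
Hessian. -/
theorem finrank_ker_hessian_and_tangent :
    Module.finrank k (LinearMap.ker (X.hessian (φ (b 0)))) = 2 ∧
    ∀ (ξ : ι → k) (η : Fin m → k), (∀ g ∈ sectionIdeal φ b L,
      (X.germ m).tangent (Sum.elim ξ η) g = 0) →
        ξ ∈ LinearMap.ker (X.hessian (φ (b 0))) ∧ η = 0 := by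
  obtain ⟨s, hsm, hs⟩ := hS
  have h2 := X.two_le_finrank_ker_hessian hι (ε_D_phi_zero X hcrit hbase) hH
  let K := LinearMap.ker (X.hessian (φ (b 0)))
  let T : Submodule k (ι ⊕ Fin m → k) :=
    { carrier := {v | ∀ g ∈ sectionIdeal φ b L, (X.germ m).tangent v g = 0}
      zero_mem' := fun g _ => by simp [LocalCoords.tangent_eq_sum]
      add_mem' := fun {v w} hv hw g hg => by
        rw [LocalCoords.tangent_add, LinearMap.add_apply, hv g hg, hw g hg, add_zero]
      smul_mem' := fun r v hv g hg => by
        rw [LocalCoords.tangent_smul, LinearMap.smul_apply, hv g hg, smul_zero] }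
  let e : K →ₗ[k] T :=
    { toFun := fun c => ⟨Sum.elim c 0, fun g hg => tangent_ker_hessian X hcrit hbase hL c.2 hg⟩
      map_add' := fun c d => Subtype.ext (by ext (i | i) <;> simp)
      map_smul' := fun r c => Subtype.ext (by ext (i | i) <;> simp) }
  have he : Function.Injective e := fun c d hcd => Subtype.ext (funext fun i =>
    congrFun (congrArg Subtype.val hcd) (Sum.inl i))
  let w : T →ₗ[k] (Fin 2 → k) :=
    { toFun := fun v i => (X.germ m).tangent v (s i)
      map_add' := fun v w => by ext i; simp [LocalCoords.tangent_add]
      map_smul' := fun r v => by ext i; simp [LocalCoords.tangent_smul] }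
  -- Two functions generate the maximal ideal modulo the ideal of the section, so a tangent vector
  -- is determined by its values on them. Thus `dim T ≤ 2 ≤ dim K`, and `e` is onto.
  have hw : Function.Injective w := by
    rw [← LinearMap.ker_eq_bot, LinearMap.ker_eq_bot']
    intro v hv
    refine Subtype.ext (funext fun j => ?_)
    obtain ⟨r, hr⟩ := hs _ ((X.germ m).x_mem j)
    have h := v.2 _ hr
    rw [map_sub, LocalCoords.tangent_x, map_sum, sub_eq_zero] at h
    rw [h]
    refine Finset.sum_eq_zero fun i _ => ?_
    have hvi : (X.germ m).tangent v (s i) = 0 := congrFun hv i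
    rw [LocalCoords.tangent_mul, hvi, ((X.germ m).ε_eq_zero_iff).mpr (hsm i)]
    simp
  have hT : Module.finrank k T ≤ 2 := by
    simpa using LinearMap.finrank_le_finrank_of_injective hw
  have hKT : Module.finrank k K ≤ Module.finrank k T :=
    LinearMap.finrank_le_finrank_of_injective he
  have hsurj : Function.Surjective e :=
    (LinearMap.injective_iff_surjective_of_finrank_eq_finrank
      (le_antisymm hKT (hT.trans h2))).mp he
  refine ⟨le_antisymm (hKT.trans hT) h2, fun ξ η h => ?_⟩
  obtain ⟨c, hc⟩ := hsurj ⟨Sum.elim ξ η, h⟩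
  have hc' : Sum.elim (c : ι → k) 0 = Sum.elim ξ η := congrArg Subtype.val hc
  have h1 : (c : ι → k) = ξ := funext fun i => congrFun hc' (Sum.inl i)
  exact ⟨h1 ▸ c.2, (funext fun i => congrFun hc' (Sum.inr i)).symm⟩

include X in
/-- A formal curve in the section whose ring has no regular parameter along the curve has
order at least two. -/
theorem sq_dvd_of_not_principal {Λ : Submodule k M} (hΛ : b 0 ∈ Λ)
    (χ : GermRing O m →ₐ[k] PowerSeries k)
    (h1 : ∀ g ∈ maximalIdeal (GermRing O m), PowerSeries.X ∣ χ g)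
    (hprin : ∀ u ∈ maximalIdeal (GermRing O m), PowerSeries.coeff 1 (χ u) ≠ 0 →
      ∀ g ∈ maximalIdeal (GermRing O m), ∃ r, g - r * u ∈ sectionIdeal φ b Λ) :
    ∀ g ∈ maximalIdeal (GermRing O m), PowerSeries.X ^ 2 ∣ χ g := by
  obtain ⟨hK, -⟩ := finrank_ker_hessian_and_tangent X hcrit hbase hι hH hL hS
  by_contra! hc
  obtain ⟨u, hu, hu2⟩ := hc
  have hu1 : PowerSeries.coeff 1 (χ u) ≠ 0 := by
    intro h
    apply hu2
    have h0 := h1 u hu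
    rw [PowerSeries.X_dvd_iff] at h0
    rw [PowerSeries.X_pow_dvd_iff]
    intro j hj
    interval_cases j
    · simpa using h0
    · exact h
  let K := LinearMap.ker (X.hessian (φ (b 0)))
  let w : K →ₗ[k] k :=
    { toFun := fun c => (X.germ m).tangent (Sum.elim c 0) u
      map_add' := fun c d => by
        rw [← LinearMap.add_apply, ← LocalCoords.tangent_add, ← Sum.elim_add_add, add_zero]
        rfl
      map_smul' := fun r c => by
        rw [RingHom.id_apply, ← LinearMap.smul_apply, ← LocalCoords.tangent_smul]
        congr 2
        ext (i | i) <;> simp }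
  -- One linear condition on the plane `K` leaves a nonzero `c` that kills `u`.
  have hker : LinearMap.ker w ≠ ⊥ := LinearMap.ker_ne_bot_of_finrank_lt (by
    rw [hK, Module.finrank_self]; norm_num)
  obtain ⟨c, hc, hc0⟩ := Submodule.exists_mem_ne_zero_of_ne_bot hker
  apply hc0
  refine Subtype.ext (funext fun j => ?_)
  -- Modulo the ideal of the curve every `x_j` is a multiple of `u`, and `(c, 0)` kills both `u` and
  -- that ideal; so `c = 0`.
  obtain ⟨r, hr⟩ := hprin u hu hu1 _ ((X.germ m).x_mem (Sum.inl j))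
  have h := tangent_ker_hessian X hcrit hbase hΛ c.2 hr
  have hcu : (X.germ m).tangent (Sum.elim c 0) u = 0 := hc
  rw [map_sub, LocalCoords.tangent_x, LocalCoords.tangent_mul, hcu,
    ((X.germ m).ε_eq_zero_iff).mpr hu] at h
  simpa using h

include X in
/-- The expansions of the affine coordinates along a formal curve of order at least two. -/
theorem coeff_coordY_eq_zero (χ : GermRing O m →ₐ[k] PowerSeries k)
    (hχ : ∀ g ∈ sectionIdeal φ b L, χ g = 0)
    (h2 : ∀ g ∈ maximalIdeal (GermRing O m), PowerSeries.X ^ 2 ∣ χ g) (i : Fin m) :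
    PowerSeries.X ^ 4 ∣ χ (coordY O i) ∧ PowerSeries.coeff 5 (χ (coordY O i)) = 0 := by
  obtain ⟨hK, hT⟩ := finrank_ker_hessian_and_tangent X hcrit hbase hι hH hL hS
  let f := φ (b 0)
  let a : ℕ → ι → k := fun c j => PowerSeries.coeff c (χ (algebraMap O _ (X.x j)))
  let y : ℕ → Fin m → k := fun c j => PowerSeries.coeff c (χ (coordY O j))
  have hv : ∀ c, (X.germ m).curveCoeff χ c = Sum.elim (a c) (y c) := fun c => by
    ext (j | j) <;> rfl
  -- Below degree `4 = 2 · 2` the coefficient vectors are tangent to the section, hence lie in `K ×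
  -- 0`.
  have h23 : ∀ c, 0 < c → c < 4 → a c ∈ LinearMap.ker (X.hessian f) ∧ y c = 0 := by
    intro c h0 h4
    apply hT
    intro g hg
    rw [← hv, ← (X.germ m).coeff_eq_tangent χ h2 h0 h4, hχ g hg, map_zero]
  have hy4 : ∀ j, PowerSeries.X ^ 4 ∣ χ (coordY O j) := by
    intro j
    rw [PowerSeries.X_pow_dvd_iff]
    intro c hc
    rcases Nat.eq_zero_or_pos c with rfl | h0
    · exact (PowerSeries.X_pow_dvd_iff.mp (h2 _ (coordY_mem j))) 0 (by norm_num)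
    · exact congrFun (h23 c h0 hc).2 j
  refine ⟨hy4 i, ?_⟩
  let χO : O →ₐ[k] PowerSeries k := χ.comp (IsScalarTower.toAlgHom k O (GermRing O m))
  have hχO : ∀ g : O, χ (algebraMap O _ g) = χO g := fun _ => rfl
  have h2O : ∀ g ∈ maximalIdeal O, PowerSeries.X ^ 2 ∣ χO g := by
    intro g hg
    refine h2 (algebraMap O _ g) ?_
    rw [← (X.germ m).ε_eq_zero_iff, LocalCoords.germ_ε_algebraMap, X.ε_eq_zero_iff]
    exact hg
  -- `y_j` starts in degree 4 and `g` has no linear term, so only the value of `g` at `p` enters.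
  have hmul : ∀ (g : O) (j : Fin m),
      PowerSeries.coeff 5 (χ (coordY O j * algebraMap O _ g)) = y 5 j * X.ε g := by
    intro g j
    have hd := X.dvd_sub_C χO h2O g
    rw [PowerSeries.X_pow_dvd_iff] at hd
    have hd0 := hd 0 (by norm_num)
    have hd1 := hd 1 (by norm_num)
    rw [map_sub, sub_eq_zero, PowerSeries.coeff_C] at hd0 hd1
    rw [if_pos rfl] at hd0
    rw [if_neg one_ne_zero] at hd1
    rw [mul_comm, map_mul, hχO, coeff_five_mul hd1 (hy4 j), hd0, mul_comm]
  have hcoeff : ∀ g : O, g ∈ maximalIdeal O ^ 2 →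
      PowerSeries.coeff 5 (χO g) = X.tangent (a 2) (X.field (a 3) g) := fun g hg =>
    X.coeff_five_eq χO h2O hg
  have ha2 := (h23 2 (by norm_num) (by norm_num)).1
  have ha3 := (h23 3 (by norm_num) (by norm_num)).1
  have hf0 : X.ε f = 0 := X.ε_eq_zero_iff.mpr (phi_zero_mem φ b hcrit)
  have hfsq : f ∈ maximalIdeal O ^ 2 := X.mem_sq_of_ε_D_eq_zero hf0 (ε_D_phi_zero X hcrit hbase)
  have hf5 : PowerSeries.coeff 5 (χO f) = 0 := by
    rw [hcoeff f hfsq, ← LocalCoords.hessian_apply, LinearMap.mem_ker.mp ha2,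
      LinearMap.zero_apply]
  have hw2 : ∑ j, y 5 j * X.ε (φ (b j.succ)) = 0 := by
    have h := congrArg (PowerSeries.coeff 5) (hχ _ (Ideal.mem_sup_left
      (span_universalEq_le_critIdeal φ b (Ideal.mem_span_singleton_self _))))
    rw [universalEq_eq, map_add, map_add, map_sum, map_sum, hχO, hf5, zero_add, map_zero] at h
    simpa only [hmul] using h
  -- Only directions in `K` are used: for them `D_c f ∈ 𝔪²`, so its degree 5 coefficient is a third
  -- derivative of `f` along `K`, which vanishes.
  have hw3 : ∀ c ∈ LinearMap.ker (X.hessian f),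
      ∑ j, y 5 j * X.ε (X.field c (φ (b j.succ))) = 0 := by
    intro c hc
    have hsq : X.field c f ∈ maximalIdeal O ^ 2 := by
      apply X.mem_sq_of_ε_D_eq_zero
      · rw [X.field_apply, map_sum]
        refine Finset.sum_eq_zero fun i _ => ?_
        rw [map_smul, ε_D_phi_zero X hcrit hbase, smul_zero]
      · intro l
        have h := LinearMap.congr_fun (LinearMap.mem_ker.mp hc) (Pi.single l 1)
        rw [X.hessian_symm, LocalCoords.hessian_apply, LocalCoords.tangent_eq_sum] at h
        simpa [Pi.single_apply] using h
    have h5 : PowerSeries.coeff 5 (χO (X.field c f)) = 0 := by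
      rw [hcoeff _ hsq, LocalCoords.tangent_apply, X.field_field_field_eq_zero hK ha2 ha3 hc,
        map_zero]
    have h := congrArg (PowerSeries.coeff 5) (hχ _ (Ideal.mem_sup_left
      (universalEqDeriv_field_mem X hcrit hbase c)))
    rw [universalEqDeriv, map_add, map_add, map_sum, map_sum, hχO, h5, zero_add, map_zero] at h
    simpa only [hmul] using h
  have hw1 : ∑ j, y 5 j • b j.succ ∈ L := by
    refine mem_of_forall_dual fun l hl => ?_
    have h := congrArg (PowerSeries.coeff 5) (hχ _ (linearEq_mem_sectionIdeal hL hl))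
    rw [linearEq, map_sum, map_sum, map_zero] at h
    simp only [IsScalarTower.algebraMap_apply k O (GermRing O m), hmul, AlgHom.commutes] at h
    rw [map_sum]
    simpa using h
  let U : Module.Dual k (ι → k) :=
    { toFun := fun c => ∑ j, y 5 j * X.ε (X.field c (φ (b j.succ)))
      map_add' := fun c d => by
        simp [LocalCoords.field_add, mul_add, Finset.sum_add_distrib]
      map_smul' := fun r c => by
        simp [LocalCoords.field_smul, Finset.mul_sum, mul_left_comm] }
  -- The sign makes `(ξ, y 5)` satisfy the linearized equations `D_j σ = 0` in all directions, not
  -- only those in `K`.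
  obtain ⟨ξ, hξ⟩ := X.exists_hessian_eq (f := f) (u := -U) (fun c hc => by
    rw [LinearMap.neg_apply, neg_eq_zero]; exact hw3 c hc)
  have hfin := hT ξ (y 5) (fun g hg =>
    tangent_sectionIdeal_eq_zero X hcrit hbase hL hw1 hw2 (fun j => by
      have h := hξ (Pi.single j 1)
      have hs : ∀ g, X.field (Pi.single j 1) g = X.D j g := fun g => by
        simp [LocalCoords.field_apply, Pi.single_apply]
      rw [X.hessian_symm, LocalCoords.hessian_apply, hs, LinearMap.neg_apply] at h
      rw [h]
      simp [U, hs]) hg)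
  exact congrFun hfin.2 i

end

end LinearSystem

/-! ### From germs to the completed pull-back. -/

section CompletedPullback

variable {k O : Type*} [Field k] [CommRing O] [IsLocalRing O] [Algebra k O] {m : ℕ}

instance essFiniteType_germRing [Algebra.EssFiniteType k O] :
    Algebra.EssFiniteType k (GermRing O m) := by
  have h1 : Algebra.EssFiniteType (MvPolynomial (Fin m) O) (GermRing O m) :=
    Algebra.EssFiniteType.of_isLocalization _ (originIdeal O m).primeCompl
  have h2 : Algebra.EssFiniteType O (GermRing O m) :=
    Algebra.EssFiniteType.comp O (MvPolynomial (Fin m) O) _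
  exact Algebra.EssFiniteType.comp k O _

theorem exists_fin_span_eq {S : Type*} [CommRing S] {I : Ideal S} (hI : I.FG) {d : ℕ}
    (hd : I.spanFinrank = d) : ∃ s : Fin d → S, Ideal.span (Set.range s) = I := by
  have h := Submodule.FG.generators_ncard hI
  have hfin : (Submodule.generators I).Finite := Submodule.FG.finite_generators hI
  rw [hd] at h
  have : Finite (Submodule.generators I) := hfin
  let e : Fin d ≃ Submodule.generators I :=
    (Finite.equivFinOfCardEq (by rwa [Nat.card_coe_set_eq])).symm
  refine ⟨fun i => e i, ?_⟩
  have : Set.range (fun i => (e i : S)) = Submodule.generators I := by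
    rw [Set.range_comp' Subtype.val e, e.surjective.range_eq, Set.image_univ, Subtype.range_coe]
  rw [this]
  exact Submodule.span_generators I

variable {M : Type*} [AddCommGroup M] [Module k M] {φ : M →ₗ[k] O}
  {b : Module.Basis (Fin (m + 1)) k M}

/-- This extracts from regularity in dimension 2 that the maximal ideal has two generators, stated
upstairs modulo the ideal of the section. -/
theorem exists_lift_generators {L : Submodule k M} (hSL : IsRegularLocalRing (SectionRing φ b L))
    (hdim : ringKrullDim (SectionRing φ b L) = 2) :
    ∃ s : Fin 2 → GermRing O m, (∀ i, s i ∈ maximalIdeal (GermRing O m)) ∧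
      ∀ g ∈ maximalIdeal (GermRing O m), ∃ r : Fin 2 → GermRing O m,
        g - ∑ i, r i * s i ∈ sectionIdeal φ b L := by
  have hq := Ideal.Quotient.mk_surjective (I := sectionIdeal φ b L)
  have hloc := IsLocalHom.of_surjective _ hq
  have hrank : (maximalIdeal (SectionRing φ b L)).spanFinrank = 2 := by
    have := hSL.spanFinrank_maximalIdeal
    rw [hdim] at this
    exact_mod_cast this
  obtain ⟨s, hs⟩ := exists_fin_span_eq (IsNoetherian.noetherian _) hrank
  choose t ht using fun i => hq (s i)
  refine ⟨t, fun i => ?_, fun g hg => ?_⟩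
  · have h : Ideal.Quotient.mk (sectionIdeal φ b L) (t i) ∈ maximalIdeal _ := by
      rw [ht, ← hs]; exact Ideal.subset_span ⟨i, rfl⟩
    rw [mem_maximalIdeal, mem_nonunits_iff] at h ⊢
    exact fun hu => h (hu.map _)
  · have h : Ideal.Quotient.mk (sectionIdeal φ b L) g ∈ maximalIdeal _ := by
      rw [mem_maximalIdeal, mem_nonunits_iff] at hg ⊢
      exact fun hu => hg (isUnit_of_map_unit (Ideal.Quotient.mk (sectionIdeal φ b L)) _ hu)
    rw [← hs, Ideal.mem_span_range_iff_exists_fun] at h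
    obtain ⟨c, hc⟩ := h
    choose r hr using fun i => hq (c i)
    refine ⟨r, ?_⟩
    rw [← Ideal.Quotient.eq, map_sum, ← hc]
    simp [hr, ht]

/-- Up to a constant, `g` is a combination of the `y_i`. Its coefficients pull back without a linear
term, so multiplication by them creates no `z⁵` term. -/
theorem pullback_mem_subringT (χ : GermRing O m →ₐ[k] PowerSeries k)
    (h2 : ∀ g ∈ maximalIdeal (GermRing O m), PowerSeries.X ^ 2 ∣ χ g)
    (hy : ∀ i : Fin m, PowerSeries.X ^ 4 ∣ χ (coordY O i) ∧
      PowerSeries.coeff 5 (χ (coordY O i)) = 0) (g : GermRing k m) :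
    χ (pullbackPr₂ k O m g) ∈ subringT k := by
  let Y := (pointCoords k).germ m
  obtain ⟨r, hr⟩ := Y.exists_eq_add_sum g
  rw [hr, map_add, map_add, map_sum, map_sum, pullbackPr₂_algebraMap_base, AlgHom.commutes]
  refine add_mem (by simp [subringT, PowerSeries.algebraMap_eq]) ?_
  rw [Fintype.sum_sum_type]
  simp only [Finset.univ_eq_empty, Finset.sum_empty, zero_add]
  refine sum_mem fun i _ => ?_
  have hxi : pullbackPr₂ k O m (Y.x (Sum.inr i)) = coordY O i := pullbackPr₂_coordY i
  rw [map_mul, map_mul, hxi]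
  have hd : PowerSeries.X ^ 4 ∣ χ (pullbackPr₂ k O m (r (Sum.inr i))) * χ (coordY O i) :=
    (hy i).1.mul_left _
  rw [PowerSeries.X_pow_dvd_iff] at hd
  refine ⟨hd 1 (by norm_num), hd 2 (by norm_num), hd 3 (by norm_num), ?_⟩
  have h1 : PowerSeries.coeff 1 (χ (pullbackPr₂ k O m (r (Sum.inr i)))) = 0 := by
    have hm : r (Sum.inr i) - algebraMap k _ (Y.ε (r (Sum.inr i))) ∈
        maximalIdeal (GermRing k m) := by
      rw [← Y.ε_eq_zero_iff]; simp
    have hm' : pullbackPr₂ k O m (r (Sum.inr i) - algebraMap k _ (Y.ε (r (Sum.inr i)))) ∈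
        maximalIdeal (GermRing O m) := by
      rw [mem_maximalIdeal, mem_nonunits_iff] at hm ⊢
      exact fun h => hm (isUnit_of_map_unit (pullbackPr₂ k O m) _ h)
    have h := h2 _ hm'
    rw [map_sub, map_sub, pullbackPr₂_algebraMap_base, AlgHom.commutes,
      PowerSeries.X_pow_dvd_iff] at h
    have := h 1 (by norm_num)
    rwa [map_sub, PowerSeries.algebraMap_eq, PowerSeries.coeff_C, if_neg one_ne_zero,
      sub_zero] at this
  rw [coeff_five_mul h1 (hy i).1, (hy i).2, mul_zero]

theorem evalₐ_completionMap {A B : Type*} [CommRing A] [CommRing B] (I : Ideal A) (J : Ideal B)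
    (f : A →+* B) (h : I ≤ J.comap f) (n : ℕ) (g : AdicCompletion I A) :
    AdicCompletion.evalₐ J n (completionMap I J f h g) =
      Ideal.quotientMap (J ^ n) f ((Ideal.pow_right_mono h n).trans (Ideal.le_comap_pow f n))
        (AdicCompletion.evalₐ I n g) := by
  refine AdicCompletion.evalₐ_liftRingHom J _ ?_ n g
  intro a c hac
  ext x
  induction x using AdicCompletion.induction_on with
  | _ x =>
    simp only [RingHom.comp_apply, RingHom.coe_coe, AdicCompletion.evalₐ_mk,
      Ideal.quotientMap_mk, Ideal.Quotient.factorPow, Ideal.Quotient.factor_mk]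
    rw [Ideal.Quotient.eq, ← map_sub]
    exact (Ideal.pow_right_mono h a).trans (Ideal.le_comap_pow f a)
      (Ideal.Quotient.eq.mp (AdicCompletion.Ideal.mk_eq_mk I hac x))

theorem completedPullback_mem [IsAlgClosed k] [CharP k 2] [Algebra.EssFiniteType k O]
    [IsNoetherianRing O] {ι : Type*} [Fintype ι] [DecidableEq ι] (X : LocalCoords k O ι)
    (hι : Even (Fintype.card ι)) (hbase : NotBasePoint φ) (hR : IsPointOfR φ b)
    {Λ L : Submodule k M} (hfΛ : b 0 ∈ Λ) (hΛL : Λ ≤ L)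
    (hSL : IsRegularLocalRing (SectionRing φ b L)) (hSL_dim : ringKrullDim (SectionRing φ b L) = 2)
    [IsDomain (SectionRing φ b Λ)] [IsLocalRing (Normalization (SectionRing φ b Λ))]
    (z : PowerSeries k ≃ₐ[k] AdicCompletion
      (maximalIdeal (Normalization (SectionRing φ b Λ))) (Normalization (SectionRing φ b Λ)))
    (g : AdicCompletion (linearSubspaceMaxIdeal b Λ) (LinearSubspaceRing b Λ)) :
    z.symm (completedPullback φ b Λ g) ∈ subringT k := by
  obtain ⟨hcrit, hH⟩ := hR
  let C := SectionRing φ b Λ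
  let q : GermRing O m →ₐ[k] C := Ideal.Quotient.mkₐ k (sectionIdeal φ b Λ)
  have hq : Function.Surjective q := Ideal.Quotient.mk_surjective
  have hCloc : IsLocalRing C := IsLocalRing.of_surjective' (q : GermRing O m →+* C) hq
  have hqloc : IsLocalHom (q : GermRing O m →+* C) := IsLocalHom.of_surjective _ hq
  have hqmem : ∀ u ∈ maximalIdeal (GermRing O m), q u ∈ maximalIdeal C := by
    intro u hu
    rw [mem_maximalIdeal, mem_nonunits_iff] at hu ⊢
    exact fun h => hu (isUnit_of_map_unit (q : GermRing O m →+* C) _ h)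
  -- The formal branch: restrict to `C_Λ`, pull back to the normalization and expand in `z`.
  let χ : GermRing O m →ₐ[k] PowerSeries k :=
    ((expansion z).comp (IsScalarTower.toAlgHom k C (Normalization C))).comp q
  have hχ : ∀ u, χ u = expansion z (algebraMap C (Normalization C) (q u)) := fun _ => rfl
  have hχ0 : ∀ u ∈ sectionIdeal φ b Λ, χ u = 0 := fun u hu => by
    have : q u = 0 := Ideal.Quotient.eq_zero_iff_mem.mpr hu
    rw [hχ, this, map_zero, map_zero]
  have h1 : ∀ u ∈ maximalIdeal (GermRing O m), PowerSeries.X ∣ χ u := by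
    intro u hu
    rw [PowerSeries.X_dvd_iff, hχ, ← mem_maximalIdeal_iff_expansion]
    have := hqmem u hu
    rw [mem_maximalIdeal, mem_nonunits_iff] at this ⊢
    exact fun h => this (isUnit_of_map_unit (algebraMap C (Normalization C)) _ h)
  have hS := exists_lift_generators hSL hSL_dim
  have h2 := sq_dvd_of_not_principal X hcrit hbase hι hH (hΛL hfΛ) hS hfΛ χ h1
    (fun u hu hu1 v hv => by
      have hmax := maximalIdeal_eq_span_of_expansion z (hqmem u hu) hu1
      have hv' := hqmem v hv
      rw [hmax, Ideal.mem_span_singleton] at hv'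
      obtain ⟨c, hc⟩ := hv'
      obtain ⟨r, rfl⟩ := hq c
      refine ⟨r, Ideal.Quotient.eq.mp ?_⟩
      change q v = q (r * u)
      rw [hc, map_mul, mul_comm])
  have hy := coeff_coordY_eq_zero X hcrit hbase hι hH (hΛL hfΛ) hS χ
    (fun u hu => hχ0 u (sectionIdeal_anti hΛL hu)) h2
  -- Precision `z⁶` suffices, since the conditions defining `T` stop at `z⁵`; `g` is then replaced
  -- by a germ `a` agreeing with it to order `N`.
  obtain ⟨N, hN⟩ := exists_evalₐ_eq_zero_imp_dvd z 6
  obtain ⟨a, ha⟩ := Ideal.Quotient.mk_surjective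
    (AdicCompletion.evalₐ (linearSubspaceMaxIdeal b Λ) N g)
  obtain ⟨a, rfl⟩ := Ideal.Quotient.mk_surjective a
  have hT : χ (pullbackPr₂ k O m a) ∈ subringT k := pullback_mem_subringT χ h2 hy a
  have hdiff : PowerSeries.X ^ 6 ∣
      z.symm (completedPullback φ b Λ g) - χ (pullbackPr₂ k O m a) := by
    have hχa : χ (pullbackPr₂ k O m a) = z.symm (algebraMap _ _ (normalizationPullback φ b Λ
      (Ideal.Quotient.mk _ a))) := rfl
    rw [hχa, ← map_sub]
    apply hN
    rw [map_sub, completedPullback, evalₐ_completionMap, ← ha, Ideal.quotientMap_mk,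
      AlgHom.commutes, Ideal.Quotient.algebraMap_eq, sub_self]
  rw [PowerSeries.X_pow_dvd_iff] at hdiff
  obtain ⟨t1, t2, t3, t5⟩ := hT
  have hc : ∀ j < 6, PowerSeries.coeff j (z.symm (completedPullback φ b Λ g)) =
      PowerSeries.coeff j (χ (pullbackPr₂ k O m a)) := fun j hj => by
    have := hdiff j hj
    rwa [map_sub, sub_eq_zero] at this
  exact ⟨(hc 1 (by norm_num)).trans t1, (hc 2 (by norm_num)).trans t2,
    (hc 3 (by norm_num)).trans t3, (hc 5 (by norm_num)).trans t5⟩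

theorem exists_monomial_sub {k : Type*} [Field k] {F : PowerSeries k} (hF : F ∈ subringT k)
    (h0 : PowerSeries.constantCoeff F = 0) :
    ∃ a : k, PowerSeries.X ^ 6 ∣ F - PowerSeries.monomial 4 a := by
  refine ⟨PowerSeries.coeff 4 F, ?_⟩
  obtain ⟨t1, t2, t3, t5⟩ := hF
  rw [PowerSeries.X_pow_dvd_iff]
  intro j hj
  rw [map_sub, PowerSeries.coeff_monomial]
  interval_cases j <;> simp_all

theorem constantCoeff_completedPullback {Λ : Submodule k M}
    [IsLocalRing (Normalization (SectionRing φ b Λ))]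
    (z : PowerSeries k ≃ₐ[k] AdicCompletion
      (maximalIdeal (Normalization (SectionRing φ b Λ))) (Normalization (SectionRing φ b Λ)))
    (g : AdicCompletion (linearSubspaceMaxIdeal b Λ) (LinearSubspaceRing b Λ))
    (hg : AdicCompletion.evalₐ (linearSubspaceMaxIdeal b Λ) 1 g = 0) :
    PowerSeries.constantCoeff (z.symm (completedPullback φ b Λ g)) = 0 := by
  rw [← evalₐ_one_eq_zero_iff, completedPullback, evalₐ_completionMap, hg, map_zero]

end CompletedPullback

/-! ### Coordinates from a basis of the differentials. -/

section SmoothCoordinates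

variable {k : Type*} [Field k] {O : Type*} [CommRing O] [IsLocalRing O] [Algebra k O]

theorem sub_algebraMap_mem_maximalIdeal {ε : O →ₐ[k] k} (hε : RingHom.ker ε = maximalIdeal O)
    (g : O) : g - algebraMap k O (ε g) ∈ maximalIdeal O := by
  rw [← hε, RingHom.mem_ker, map_sub, AlgHom.commutes]
  simp

/-- The derivation `g ↦ [g - g(p)]` with values in the cotangent space. -/
def cotangentDerivation (ε : O →ₐ[k] k) (hε : RingHom.ker ε = maximalIdeal O) :
    Derivation k O (maximalIdeal O).Cotangent :=
  Derivation.mk'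
    { toFun := fun g => (maximalIdeal O).toCotangent
        ⟨g - algebraMap k O (ε g), sub_algebraMap_mem_maximalIdeal hε g⟩
      map_add' := fun g h => by
        rw [← map_add]
        congr 1
        ext
        simp only [map_add, Submodule.coe_add]
        ring
      map_smul' := fun c g => by
        rw [RingHom.id_apply, ← algebraMap_smul O c ((maximalIdeal O).toCotangent _), ← map_smul]
        congr 1
        ext
        simp [Algebra.smul_def, mul_sub] }
    fun g h => by
      simp only [LinearMap.coe_mk, AddHom.coe_mk]
      rw [← map_smul, ← map_smul, ← map_add, Ideal.toCotangent_eq]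
      have := Ideal.mul_mem_mul (sub_algebraMap_mem_maximalIdeal hε g)
        (sub_algebraMap_mem_maximalIdeal hε h)
      rw [← pow_two] at this
      have h2 := neg_mem this
      convert h2 using 1
      simp only [Submodule.coe_add, SetLike.val_smul, smul_eq_mul, map_mul]
      ring

theorem cotangentDerivation_apply_of_mem (ε : O →ₐ[k] k) (hε : RingHom.ker ε = maximalIdeal O)
    (g : maximalIdeal O) : cotangentDerivation ε hε g = (maximalIdeal O).toCotangent g := by
  have : ε (g : O) = 0 := by
    rw [← RingHom.mem_ker, hε]
    exact g.2
  change (maximalIdeal O).toCotangent _ = _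
  congr 1
  ext
  simp [this]

/-- The differentials map onto the cotangent space, so the images of a basis span it; Nakayama lifts
them to generators of the maximal ideal. -/
theorem exists_span_maximalIdeal_of_basis [IsNoetherianRing O] (ε : O →ₐ[k] k)
    (hε : RingHom.ker ε = maximalIdeal O) {ι : Type*} (B : Module.Basis ι O (Ω[O⁄k])) :
    ∃ x : ι → O, Ideal.span (Set.range x) = maximalIdeal O := by
  set L := (cotangentDerivation ε hε).liftKaehlerDifferential with hL
  choose x hx using fun i => (maximalIdeal O).toCotangent_surjective (L (B i))
  refine ⟨fun i => x i, le_antisymm ?_ ?_⟩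
  · rw [Ideal.span_le]
    rintro _ ⟨i, rfl⟩
    exact (x i).2
  refine Submodule.le_of_le_smul_of_le_jacobson_bot (I := maximalIdeal O)
    (IsNoetherian.noetherian _) (IsLocalRing.maximalIdeal_le_jacobson _) ?_
  intro g hg
  have hmem : L (KaehlerDifferential.D k O g) ∈ Submodule.span O (Set.range fun i => L (B i)) := by
    have : KaehlerDifferential.D k O g ∈ Submodule.span O (Set.range B) := by
      rw [B.span_eq]
      trivial
    have := Submodule.mem_map_of_mem (f := L) this
    rwa [Submodule.map_span, ← Set.range_comp] at this
  rw [hL, Derivation.liftKaehlerDifferential_comp_D,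
    cotangentDerivation_apply_of_mem ε hε ⟨g, hg⟩] at hmem
  simp_rw [← hL, ← hx] at hmem
  rw [show (Set.range fun i => (maximalIdeal O).toCotangent (x i)) =
    (maximalIdeal O).toCotangent '' Set.range x from (Set.range_comp _ _),
    ← Submodule.map_span] at hmem
  obtain ⟨y, hy, hyg⟩ := hmem
  rw [Ideal.toCotangent_eq] at hyg
  have hy' : (y : O) ∈ Ideal.span (Set.range fun i => (x i : O)) := by
    have := Submodule.mem_map_of_mem (f := (maximalIdeal O).subtype) hy
    rwa [Submodule.map_span, ← Set.range_comp] at this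
  rw [smul_eq_mul, ← pow_two, ← sub_sub_cancel (y : O) g]
  exact sub_mem (Submodule.mem_sup_left hy') (Submodule.mem_sup_right hyg)

/-- The `d x_i` generate the differentials by Nakayama. Being as many as the rank of a free module,
they form a basis, and the dual basis gives the derivations. -/
theorem nonempty_localCoords_of_basis [IsNoetherianRing O] (ε : O →ₐ[k] k)
    (hε : RingHom.ker ε = maximalIdeal O) {ι : Type*} [Fintype ι] [DecidableEq ι]
    (B : Module.Basis ι O (Ω[O⁄k])) : Nonempty (LocalCoords k O ι) := by
  obtain ⟨x, hx⟩ := exists_span_maximalIdeal_of_basis ε hε B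
  let d := KaehlerDifferential.D k O
  have : Module.Finite O (Ω[O⁄k]) := .of_basis B
  have hspan : Submodule.span O (Set.range fun i => d (x i)) = ⊤ := by
    rw [eq_top_iff]
    refine Submodule.le_of_le_smul_of_le_jacobson_bot (I := maximalIdeal O)
      (Module.Finite.fg_top) (IsLocalRing.maximalIdeal_le_jacobson _) ?_
    rw [← KaehlerDifferential.span_range_derivation, Submodule.span_le]
    rintro _ ⟨g, rfl⟩
    have hg := sub_algebraMap_mem_maximalIdeal hε g
    have hdg : d g = d (g - algebraMap k O (ε g)) := by simp
    change d g ∈ _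
    rw [hdg]
    rw [← hx, Ideal.span, Submodule.mem_span_range_iff_exists_fun] at hg
    obtain ⟨c, hc⟩ := hg
    rw [← hc, map_sum]
    refine sum_mem fun i _ => ?_
    rw [smul_eq_mul, Derivation.leibniz]
    refine add_mem (Submodule.mem_sup_left (Submodule.smul_mem _ _
      (Submodule.subset_span ⟨i, rfl⟩))) (Submodule.mem_sup_right ?_)
    refine Submodule.smul_mem_smul ?_ ?_
    · rw [← hx]
      exact Ideal.subset_span ⟨i, rfl⟩
    · exact Submodule.subset_span ⟨_, rfl⟩
  let f : (ι → O) →ₗ[O] Ω[O⁄k] := Fintype.linearCombination O fun i => d (x i)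
  have hf : Function.Surjective f := by
    rw [← LinearMap.range_eq_top, Fintype.range_linearCombination, hspan]
  have hinj : Function.Injective f := by
    have h1 : Function.Surjective (B.equivFun.toLinearMap ∘ₗ f) :=
      B.equivFun.surjective.comp hf
    have h2 := OrzechProperty.injective_of_surjective_endomorphism _ h1
    exact Function.Injective.of_comp (f := B.equivFun) h2
  let F := LinearEquiv.ofBijective f ⟨hinj, hf⟩
  refine ⟨{ x := x, D := fun i => (LinearMap.proj i ∘ₗ F.symm.toLinearMap).compDer d,
            ε := ε, ker_ε := hε, span_x := hx, D_x := fun i j => ?_ }⟩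
  have : F.symm (d (x j)) = Pi.single j 1 := by
    rw [LinearEquiv.symm_apply_eq]
    change _ = f (Pi.single j 1)
    rw [Fintype.linearCombination_apply_single, one_smul]
  change F.symm (d (x j)) i = _
  rw [this, Pi.single_apply]

/-- By the Nullstellensatz the residue field at a maximal ideal is `k`, and evaluation extends to
the localization. -/
theorem exists_algHom_ker_eq_maximalIdeal [IsAlgClosed k] {A : Type*} [CommRing A] [Algebra k A]
    [Algebra.FiniteType k A] (P : Ideal A) [P.IsMaximal] [Algebra A O] [IsScalarTower k A O]
    [IsLocalization.AtPrime O P] : ∃ ε : O →ₐ[k] k, RingHom.ker ε = maximalIdeal O := by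
  let _ : Field (A ⧸ P) := Ideal.Quotient.field P
  have : Module.Finite k (A ⧸ P) := finite_of_finite_type_of_isJacobsonRing k (A ⧸ P)
  have hbij : Function.Bijective (algebraMap k (A ⧸ P)) :=
    IsAlgClosed.algebraMap_bijective_of_isIntegral
  let q : (A ⧸ P) ≃ₐ[k] k := (AlgEquiv.ofBijective (Algebra.ofId k (A ⧸ P)) hbij).symm
  let εA : A →ₐ[k] k := q.toAlgHom.comp (Ideal.Quotient.mkₐ k P)
  have hu : ∀ y : P.primeCompl, IsUnit (εA y) := fun y => by
    rw [isUnit_iff_ne_zero]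
    intro h
    apply y.2
    have : Ideal.Quotient.mk P y = 0 := q.injective (by simpa [εA] using h)
    exact Ideal.Quotient.eq_zero_iff_mem.mp this
  let ε : O →ₐ[k] k := IsLocalization.liftAlgHom (M := P.primeCompl) (f := εA) hu
  refine ⟨ε, IsLocalRing.eq_maximalIdeal (RingHom.ker_isMaximal_of_surjective ε.toRingHom
    fun c => ⟨algebraMap k O c, by simp⟩)⟩

/-- At a maximal ideal, a standard smooth algebra of relative dimension `n` over an algebraically
closed field has local coordinates `x₁, …, xₙ` with dual derivations. -/
theorem nonempty_localCoords_of_isStandardSmooth [IsAlgClosed k] {A : Type*} [CommRing A]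
    [Algebra k A] (n : ℕ) [hA : Algebra.IsStandardSmoothOfRelativeDimension n k A] (P : Ideal A)
    [P.IsMaximal] [Algebra A O] [IsScalarTower k A O] [IsLocalization.AtPrime O P] :
    Algebra.EssFiniteType k O ∧ IsNoetherianRing O ∧ Nonempty (LocalCoords k O (Fin n)) := by
  have := hA.isStandardSmooth
  have : Algebra.FinitePresentation k A := inferInstance
  have : Algebra.FiniteType k A := inferInstance
  have : Algebra.EssFiniteType A O := Algebra.EssFiniteType.of_isLocalization O P.primeCompl
  have hess : Algebra.EssFiniteType k O := Algebra.EssFiniteType.comp k A O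
  have hnoe : IsNoetherianRing O := Algebra.EssFiniteType.isNoetherianRing k O
  obtain ⟨ε, hε⟩ := exists_algHom_ker_eq_maximalIdeal (k := k) (O := O) P
  have : Nontrivial A := (algebraMap A O).domain_nontrivial
  have hrank := Algebra.IsStandardSmoothOfRelativeDimension.rank_kaehlerDifferential
    (R := k) (S := A) n
  have : Module.Free A (Ω[A⁄k]) := inferInstance
  have : Module.Finite A (Ω[A⁄k]) := inferInstance
  let B : Module.Basis (Fin n) A (Ω[A⁄k]) :=
    Module.finBasisOfFinrankEq A _ (Module.finrank_eq_of_rank_eq hrank)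
  exact ⟨hess, hnoe, nonempty_localCoords_of_basis ε hε
    (B.ofIsLocalizedModule O P.primeCompl (KaehlerDifferential.map k k A O))⟩

end SmoothCoordinates

/-! ### Local coordinates at a smooth closed point of a scheme. -/

section SmoothPoint

variable {k : Type u} [Field k] {X : Scheme.{u}} (π : X ⟶ Spec (.of k))

theorem opens_spec_field_eq_top {W : (Spec (.of k)).Opens} {y : Spec (.of k)} (hy : y ∈ W) :
    W = ⊤ := by
  have : Subsingleton (Spec (.of k)) := inferInstanceAs (Subsingleton (PrimeSpectrum k))
  ext z
  simp [Subsingleton.elim z y, hy]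

/-- `Spec k` is a single point, so the affine open of the base in the local form of smoothness is
everything, and the chart is standard smooth over `k` itself. -/
theorem exists_isStandardSmooth_of_isSmoothOfDimAt {n : ℕ} {p : X} (h : IsSmoothOfDimAt π n p) :
    ∃ V : X.Opens, IsAffineOpen V ∧ p ∈ V ∧
      ((X.presheaf.map (homOfLE le_top : V ⟶ ⊤).op).hom.comp
        (scalars π)).IsStandardSmoothOfRelativeDimension n := by
  obtain ⟨U, hpU, hU⟩ := h
  obtain ⟨W, hW, V, hV, hpV, e, hs⟩ :=
    hU.exists_isStandardSmoothOfRelativeDimension ⟨p, hpU⟩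
  obtain rfl := opens_spec_field_eq_top (e hpV)
  refine ⟨U.ι ''ᵁ V, hV.image_of_isOpenImmersion U.ι, ⟨⟨p, hpU⟩, hpV, rfl⟩, ?_⟩
  have h1 := hs.comp (RingHom.IsStandardSmoothOfRelativeDimension.equiv
    (Scheme.ΓSpecIso (.of k)).symm.commRingCatIsoToRingEquiv)
  have h2 : (U.ι ≫ π).appLE ⊤ V e =
      π.appTop ≫ X.presheaf.map (homOfLE le_top : U.ι ''ᵁ V ⟶ ⊤).op := by
    rw [Scheme.Hom.appLE, Scheme.Hom.comp_app, Scheme.Opens.ι_app]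
    refine (Category.assoc π.appTop _ _).trans ?_
    exact congrArg (π.appTop ≫ ·) (X.presheaf.map_comp _ _).symm
  rw [h2] at h1
  rw [add_zero] at h1
  exact h1

theorem nonempty_localCoords_of_isSmoothOfDimAt [IsAlgClosed k] {n : ℕ} {p : X}
    (hp : IsClosed {p}) (h : IsSmoothOfDimAt π n p) :
    Algebra.EssFiniteType k (LocalRingAt π p) ∧ IsNoetherianRing (LocalRingAt π p) ∧
      Nonempty (LocalCoords k (LocalRingAt π p) (Fin n)) := by
  obtain ⟨V, hV, hpV, hs⟩ := exists_isStandardSmooth_of_isSmoothOfDimAt π h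
  let _ : Algebra k Γ(X, V) :=
    ((X.presheaf.map (homOfLE le_top : V ⟶ ⊤).op).hom.comp (scalars π)).toAlgebra
  have : Algebra.IsStandardSmoothOfRelativeDimension n k Γ(X, V) := hs
  let _ : Algebra Γ(X, V) (LocalRingAt π p) := (germAt π p hpV).toAlgebra
  have : IsScalarTower k Γ(X, V) (LocalRingAt π p) := .of_algebraMap_eq fun c =>
    (X.presheaf.germ_res_apply (homOfLE le_top : V ⟶ ⊤) p hpV (scalars π c)).symm
  have hmax := hV.primeIdealOf_isMaximal_of_isClosed ⟨p, hpV⟩ hp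
  have : IsLocalization.AtPrime (LocalRingAt π p) (hV.primeIdealOf ⟨p, hpV⟩).asIdeal :=
    hV.isLocalization_stalk ⟨p, hpV⟩
  exact nonempty_localCoords_of_isStandardSmooth n (hV.primeIdealOf ⟨p, hpV⟩).asIdeal

end SmoothPoint

end

end DualVar

theorem proposition5p7 {k : Type u} [Field k] [IsAlgClosed k] [CharP k 2]
    -- a projective variety `X` over `k`, a line bundle on it and a linear system `M`
    {X : Scheme.{u}} [IsIntegral X] (π : X ⟶ Spec (.of k)) (hX : IsProjective π)
    (n m : ℕ) (hn : 0 < n) (hn_even : Even n) (hnm : n < m)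
    (𝓛 : X.Modules) (h𝓛 : IsLineBundle 𝓛) (M : Submodule k (GlobalSections π 𝓛))
    -- a closed point `p` at which `X` is smooth of dimension `n`, with a local frame of `𝓛`
    (p : X) (hp : IsClosed {p}) (hp_smooth : IsSmoothOfDimAt π n p)
    (U : X.Opens) (hpU : p ∈ U) (e : Γ(𝓛, U)) (he : IsFrame 𝓛 e)
    (φ : M →ₗ[k] LocalRingAt π p) (hφ : φ = localExpression π 𝓛 e he p hpU ∘ₗ M.subtype)
    (hp_base : NotBasePoint φ) (hp_imm : IsImmersiveAt φ)
    -- homogeneous coordinates of the space of lines in `M`, with origin `[f]`, `f = b 0`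
    (b : Module.Basis (Fin (m + 1)) k M) (hR : IsPointOfR φ b)
    -- linear subspaces `[f] ∈ Λ ⊆ L` of dimensions 2 and 3, given by subspaces of `M`
    (Λ L : Submodule k M) (hΛ : Module.finrank k Λ = 3) (hL : Module.finrank k L = 4)
    (hfΛ : b 0 ∈ Λ) (hΛL : Λ ≤ L)
    -- `SL` is smooth of dimension 2 at `P`
    (hSL : IsRegularLocalRing (SectionRing φ b L)) (hSL_dim : ringKrullDim (SectionRing φ b L) = 2)
    -- `C_Λ` is of codimension 1 in `SL` at `P`, reduced and irreducible locally at `P`, and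
    -- its normalization has a single point `P'` over `P`
    (hC_dim : ringKrullDim (SectionRing φ b Λ) + 1 = ringKrullDim (SectionRing φ b L))
    [IsDomain (SectionRing φ b Λ)] [IsLocalRing (Normalization (SectionRing φ b Λ))]
    -- a formal parameter `z` of the normalization at `P'`
    (z : PowerSeries k ≃ₐ[k] AdicCompletion
      (maximalIdeal (Normalization (SectionRing φ b Λ))) (Normalization (SectionRing φ b Λ))) :
    (∀ g : AdicCompletion (linearSubspaceMaxIdeal b Λ) (LinearSubspaceRing b Λ),
      z.symm (completedPullback φ b Λ g) ∈ subringT k) ∧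
    (∀ g : AdicCompletion (linearSubspaceMaxIdeal b Λ) (LinearSubspaceRing b Λ),
      AdicCompletion.evalₐ (linearSubspaceMaxIdeal b Λ) 1 g = 0 →
        ∃ a : k, PowerSeries.X ^ 6 ∣
          z.symm (completedPullback φ b Λ g) - PowerSeries.monomial 4 a) := by
  obtain ⟨_, _, ⟨Y⟩⟩ := nonempty_localCoords_of_isSmoothOfDimAt π hp hp_smooth
  have hmem (g) : z.symm (completedPullback φ b Λ g) ∈ subringT k :=
    completedPullback_mem Y (by simpa using hn_even) hp_base hR hfΛ hΛL hSL hSL_dim z g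
  exact ⟨hmem, fun g hg =>
    exists_monomial_sub (hmem g) (constantCoeff_completedPullback z g hg)⟩
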